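/- Let $X$ be a finite set with $n$ elements, let $W$ be a non-trivial element of the free group on $X$ (a non-trivial freely reduced word), let $p>1$ be an integer, and let $A=PSL(2,\mathbb C)=SL(2,\mathbb C)/\{\pm I\}$. Consider the groups given by the presentations $$G=\langle X,y\,;\,W(X)=y^p\rangle,\qquad G'=\langle X\,;\,W(X)=1\rangle,$$ where $y\notin X$ is an additional generator. For a group $H$ generated by a finite set $Y$, let $R_A(H)=\mathrm{Hom}(H,A)$ be its representation variety, that is, $\mathrm{Hom}(H,A)$ regarded via $\rho\mapsto(\rho(t))_{t\in Y}$ as a Zariski closed subset of the affine variety $A^{Y}$ (with its Zariski topology; it need not be irreducible), and let $\dim$ denote the Krull dimension. Then: 1. $\dim R_A(G)=\max\{3n,\ \dim R_A(G')+2\}\le 3n+1$. 2. If $\dim R_A(G')+2\ge 3n$, then $R_A(G)$ is reducible, i.e. it is the union of two proper Zariski closed subsets. -/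

import Mathlib

noncomputable section

/-- `PSL(2, ℂ)`, the quotient of `SL(2, ℂ)` by its center `{1, -1}`. -/
abbrev PSL2C : Type := Matrix.ProjectiveSpecialLinearGroup (Fin 2) ℂ

/-- The projection `SL(2, ℂ) → PSL(2, ℂ)`. -/
def toPSL2C : Matrix.SpecialLinearGroup (Fin 2) ℂ →* PSL2C :=
  QuotientGroup.mk' (Subgroup.center (Matrix.SpecialLinearGroup (Fin 2) ℂ))

/-- The coordinate algebra of the affine variety `PSL(2, ℂ)^X`, where `X` is finite: the functions
whose pullback to `SL(2, ℂ)^X` is a polynomial in the matrix entries. (The affine variety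
`PSL(2, ℂ)^X` is the quotient of `SL(2, ℂ)^X` by the finite group `{1, -1}^X`, so its regular
functions are the regular functions on `SL(2, ℂ)^X` that are constant on the fibres.) -/
def coordinateAlgebraPSL2C (X : Type*) : Subalgebra ℂ ((X → PSL2C) → ℂ) where
  carrier := {f | ∃ P : MvPolynomial (X × Fin 2 × Fin 2) ℂ,
    ∀ g : X → Matrix.SpecialLinearGroup (Fin 2) ℂ,
      f (fun x => toPSL2C (g x)) = MvPolynomial.eval (fun i => (g i.1).1 i.2.1 i.2.2) P}
  mul_mem' := by
    rintro f₁ f₂ ⟨P₁, h₁⟩ ⟨P₂, h₂⟩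
    exact ⟨P₁ * P₂, fun g => by simp [h₁ g, h₂ g]⟩
  add_mem' := by
    rintro f₁ f₂ ⟨P₁, h₁⟩ ⟨P₂, h₂⟩
    exact ⟨P₁ + P₂, fun g => by simp [h₁ g, h₂ g]⟩
  algebraMap_mem' := fun c => ⟨MvPolynomial.C c, fun g => by simp⟩

/-- The Zariski topology on a set `S` with respect to an algebra `O` of complex functions on `S`:
the closed sets are the sets of common zeros of families of functions in `O`. -/
@[reducible]
def zariskiTopology {S : Type*} (O : Subalgebra ℂ (S → ℂ)) : TopologicalSpace S :=
  TopologicalSpace.ofClosed {Z | ∃ F ⊆ (O : Set (S → ℂ)), Z = {s | ∀ f ∈ F, f s = 0}}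
    ⟨{1}, by simp [O.one_mem], by simp⟩
    (by
      intro A hA
      refine ⟨{f | f ∈ O ∧ ∃ Z ∈ A, ∀ s ∈ Z, f s = 0}, fun f hf => hf.1, ?_⟩
      ext s
      simp only [Set.mem_sInter, Set.mem_ofPred_eq]
      constructor
      · rintro hs f ⟨-, Z, hZ, hf⟩
        exact hf s (hs Z hZ)
      · intro hs Z hZ
        obtain ⟨F, hF, rfl⟩ := hA hZ
        exact fun f hf => hs f ⟨hF hf, _, hZ, fun t ht => ht f hf⟩)
    (by
      rintro _ ⟨F₁, h₁, rfl⟩ _ ⟨F₂, h₂, rfl⟩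
      refine ⟨{h | ∃ f₁ ∈ F₁, ∃ f₂ ∈ F₂, h = f₁ * f₂}, ?_, ?_⟩
      · rintro _ ⟨f₁, hf₁, f₂, hf₂, rfl⟩
        exact O.mul_mem (h₁ hf₁) (h₂ hf₂)
      · ext s
        constructor
        · rintro (hs | hs) _ ⟨f₁, hf₁, f₂, hf₂, rfl⟩
          · simp [hs f₁ hf₁]
          · simp [hs f₂ hf₂]
        · intro hs
          by_contra hcon
          simp only [Set.mem_union, Set.mem_ofPred_eq, not_or, not_forall] at hcon
          obtain ⟨⟨f₁, hf₁, hn₁⟩, f₂, hf₂, hn₂⟩ := hcon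
          have := hs _ ⟨f₁, hf₁, f₂, hf₂, rfl⟩
          simp [hn₁, hn₂] at this)

/-- The representation variety `Hom(G, PSL(2, ℂ))` of the group `G = ⟨X ; rels⟩`. -/
def RepVariety {X : Type*} (rels : Set (FreeGroup X)) : Type _ :=
  PresentedGroup rels →* PSL2C

/-- The Zariski topology on `Hom(G, PSL(2, ℂ))`: the subspace topology for the embedding
`ρ ↦ (ρ x)_{x ∈ X}` into the affine variety `PSL(2, ℂ)^X`. -/
instance repVarietyTopology {X : Type*} (rels : Set (FreeGroup X)) : TopologicalSpace (RepVariety rels) :=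
  TopologicalSpace.induced
    (fun (ρ : PresentedGroup rels →* PSL2C) (x : X) => ρ (PresentedGroup.of x))
    (zariskiTopology (coordinateAlgebraPSL2C X))

/-- The relators of `⟨X, y ; W(X) = y ^ p⟩`. The generating set is `Option X`, where `some x` is
the generator `x ∈ X` and `none` is the additional generator `y`. -/
def pinchedRelators {X : Type*} (W : FreeGroup X) (p : ℕ) : Set (FreeGroup (Option X)) :=
  {FreeGroup.map some W * (FreeGroup.of none ^ p)⁻¹}

end

/-! The map `SL(2)^Y → PSL(2)^Y` is the quotient by a finite group of sign changes, so `Hom(⟨Y ; w⟩,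
PSL(2))` has the dimension of the affine scheme of determinant-one families with `w = ±1`
(`topologicalKrullDim_repVariety`). Its dimension is at least `N` exactly when there is a family `g`
over a field with `w(g) = ±1` whose entries generate an algebra of transcendence degree at least `N`
(`natCast_le_topologicalKrullDim_of_generic`, `exists_generic_of_natCast_le_topologicalKrullDim`).
So dimensions are counted at generic points.

At a generic point of `R_A(G)`, either `W ≠ ±1`, and then the entries of `y`, a `p`-th root of `±W`,
are algebraic over those of the images of `X`, which contribute at most `3n`; or `W = ±1`, and then
the images of `X` give a point of `R_A(G')` while `y` has fixed trace and contributes at most `2`.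
Both bounds are attained: a generic family on `X` admits a root of `±W`, and a generic `y` with `y^p
= -1` can be added to any generic point of `R_A(G')`, since `p > 1`. The bound `3n + 1` says that
`dim R_A(G') < 3n`: a non-trivial word is not an identity of `PSL(2, ℂ)` (`exists_lift_ne_one`).

The representations with `W = 1` form a proper closed subset containing an irreducible closed set of
dimension at least `dim R_A(G') + 2`. If `R_A(G)` were irreducible its dimension would be larger
still, which the formula forbids once that number is at least `3n`. -/

open Algebra Cardinal MvPolynomial

noncomputable section

/-! ### Going-up for chains, integral extensions and Noether normalization. -/

section Order

variable {α β : Type*} [Preorder α] [Preorder β]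

/-- Chains lift along a surjective map with the going-up property. -/
theorem Order.krullDim_le_of_goingUp (f : α → β) (hf : Function.Surjective f)
    (hlift : ∀ a b, f a < b → ∃ a', a < a' ∧ f a' = b) : Order.krullDim β ≤ Order.krullDim α := by
  have key : ∀ (n : ℕ) (a : α) (l : LTSeries β), l.length = n → l.head = f a →
      ∃ l' : LTSeries α, l'.length = n ∧ l'.head = a := by
    intro n
    induction n with
    | zero => exact fun a l _ _ => ⟨RelSeries.singleton _ a, rfl, rfl⟩
    | succ n ih =>
      intro a l hl hh
      have h0 : l.length ≠ 0 := by omega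
      obtain ⟨a', ha', hfa'⟩ := hlift a (l.tail h0).head (by
        rw [← hh, RelSeries.head_tail]
        exact l.strictMono (by
          rw [Fin.lt_def, Fin.val_one', Nat.mod_eq_of_lt (by omega)]
          exact Nat.zero_lt_one))
      obtain ⟨l', hl', hh'⟩ := ih a' (l.tail h0) (by simp [hl]) hfa'.symm
      exact ⟨l'.cons a (by rw [hh']; exact ha'), by simp [hl'], by simp⟩
  refine iSup_le fun l => ?_
  obtain ⟨a, ha⟩ := hf l.head
  obtain ⟨l', hl', -⟩ := key l.length a l rfl ha.symm
  exact le_iSup_of_le l' (by rw [hl'])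

theorem Order.krullDim_eq_of_goingUp (f : α → β) (hmono : StrictMono f)
    (hf : Function.Surjective f) (hlift : ∀ a b, f a < b → ∃ a', a < a' ∧ f a' = b) :
    Order.krullDim α = Order.krullDim β :=
  le_antisymm (Order.krullDim_le_of_strictMono f hmono) (Order.krullDim_le_of_goingUp f hf hlift)

end Order

/-- An integral extension has the same Krull dimension. -/
theorem ringKrullDim_eq_of_isIntegral_of_injective {R S : Type*} [CommRing R] [CommRing S]
    [Algebra R S] [Algebra.IsIntegral R S] (hinj : Function.Injective (algebraMap R S)) :
    ringKrullDim S = ringKrullDim R := by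
  refine Order.krullDim_eq_of_goingUp (PrimeSpectrum.comap (algebraMap R S)) ?_ ?_ ?_
  · intro P Q hPQ
    exact Ideal.comap_lt_comap_of_integral_mem_sdiff hPQ.le
      (Set.exists_of_ssubset hPQ).choose_spec (Algebra.IsIntegral.isIntegral _)
  · intro P
    obtain ⟨Q, -, hQ, hQP⟩ := Ideal.exists_ideal_over_prime_of_isIntegral P.asIdeal (⊥ : Ideal S)
      (by
        intro x hx
        have : x = 0 := hinj (by simpa using hx)
        simp [this])
    exact ⟨⟨Q, hQ⟩, PrimeSpectrum.ext hQP⟩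
  · intro P Q hPQ
    obtain ⟨Q', hle, hQ', hQ⟩ := Ideal.exists_ideal_over_prime_of_isIntegral Q.asIdeal P.asIdeal
      hPQ.le
    refine ⟨⟨Q', hQ'⟩, lt_of_le_of_ne hle ?_, PrimeSpectrum.ext hQ⟩
    rintro rfl
    exact hPQ.ne (PrimeSpectrum.ext hQ)

/-- The Krull dimension of a finitely generated domain over a field is its transcendence degree. -/
theorem natCast_le_ringKrullDim_iff_le_trdeg (k A : Type*) [Field k] [CommRing A] [IsDomain A]
    [Algebra k A] [Algebra.FiniteType k A] (N : ℕ) :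
    (N : WithBot ℕ∞) ≤ ringKrullDim A ↔ (N : Cardinal) ≤ Algebra.trdeg k A := by
  -- Noether normalization: `A` is integral over a polynomial ring in `s` variables, so both its
  -- dimension and its transcendence degree equal `s`.
  obtain ⟨s, g, hinj, hint⟩ := exists_integral_inj_algHom_of_fg k A
  algebraize [g.toRingHom]
  have hst : IsScalarTower k (MvPolynomial (Fin s) k) A := .of_algebraMap_eq' g.comp_algebraMap.symm
  have hI : Algebra.IsIntegral (MvPolynomial (Fin s) k) A := ⟨hint⟩
  have hfs : FaithfulSMul (MvPolynomial (Fin s) k) A :=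
    (faithfulSMul_iff_algebraMap_injective _ _).mpr hinj
  rw [ringKrullDim_eq_of_isIntegral_of_injective (R := MvPolynomial (Fin s) k) (S := A) hinj]
  have h := lift_trdeg_add_eq k (MvPolynomial (Fin s) k) A
  rw [trdeg_eq_zero (R := MvPolynomial (Fin s) k) (A := A)] at h
  have h2 : Algebra.trdeg k A = s := by
    apply Cardinal.lift_injective
    rw [← h]
    simp
  rw [h2, MvPolynomial.ringKrullDim_of_isNoetherianRing, ringKrullDim_eq_zero_of_field]
  simp

/-! ### Upper bounds for transcendence degrees. -/

section Trdeg

universe v w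

variable {F L : Type*} [Field F] [Field L] [Algebra F L]

theorem trdeg_subalgebra_le_of_isAlgebraic {L : Type v} [Field L] [Algebra F L] {B : Type w}
    [CommRing B] [IsDomain B] [Algebra F B] [Algebra B L] [IsScalarTower F B L]
    [FaithfulSMul B L] (S : Subalgebra F L) (hS : ∀ y ∈ S, IsAlgebraic B y) :
    Cardinal.lift.{w} (trdeg F S) ≤ Cardinal.lift.{v} (trdeg F B) := by
  have hf : FaithfulSMul F B := (faithfulSMul_iff_algebraMap_injective _ _).mpr
    (algebraMap F B).injective
  have h1 := lift_trdeg_add_eq F B (Subalgebra.algebraicClosure B L)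
  rw [trdeg_eq_zero (R := B), Cardinal.lift_zero, add_zero] at h1
  rw [h1, Cardinal.lift_le]
  let φ : S →ₐ[F] Subalgebra.algebraicClosure B L :=
    { toFun := fun y => ⟨y, hS y y.2⟩
      map_one' := rfl
      map_mul' := fun _ _ => rfl
      map_zero' := rfl
      map_add' := fun _ _ => rfl
      commutes' := fun r => rfl }
  exact trdeg_le_of_injective φ fun a b h => Subtype.ext (Subtype.mk.inj h)

/-- Additivity in the tower `F ⊆ S₀ ⊆ S₀[x]`; passing to algebraic elements costs nothing. This is
how the contribution of `y` to the dimension is counted. -/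
theorem trdeg_adjoin_le_add (S₀ : Subalgebra F L) {ι : Type*} [Fintype ι] (x : ι → L) (s : Set L)
    (hs : ∀ y ∈ s, IsAlgebraic (Algebra.adjoin S₀ (Set.range x)) y) :
    trdeg F (Algebra.adjoin F s) ≤ trdeg F S₀ + Fintype.card ι := by
  set B := Algebra.adjoin S₀ (Set.range x) with hB
  have h1 : trdeg S₀ B ≤ Fintype.card ι := by
    have hr : B = (MvPolynomial.aeval x : MvPolynomial ι S₀ →ₐ[S₀] L).range :=
      Algebra.adjoin_range_eq_range_aeval S₀ x
    have := lift_trdeg_le_of_surjective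
      (MvPolynomial.aeval x : MvPolynomial ι S₀ →ₐ[S₀] L).rangeRestrict
      (AlgHom.rangeRestrict_surjective _)
    rw [← hr] at this
    simpa using this
  have f1 : FaithfulSMul S₀ B := (faithfulSMul_iff_algebraMap_injective _ _).mpr fun a b h =>
    Subtype.ext (congrArg (Subtype.val : B → L) h)
  have h2 : trdeg F S₀ + trdeg S₀ B = trdeg F B := trdeg_add_eq F S₀
  have f2 : FaithfulSMul B L := (faithfulSMul_iff_algebraMap_injective _ _).mpr
    Subtype.val_injective
  have h3 := trdeg_subalgebra_le_of_isAlgebraic (B := B) (Algebra.adjoin F s) (fun y hy => by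
    have hle : Algebra.adjoin F s ≤ (Subalgebra.algebraicClosure B L).restrictScalars F :=
      Algebra.adjoin_le fun y hy => hs y hy
    exact hle hy)
  rw [Cardinal.lift_le] at h3
  exact h3.trans (by rw [← h2]; gcongr)

theorem exists_algebraicIndependent_of_le_trdeg {A : Type*} [CommRing A] [IsDomain A] [Algebra F A]
    {N : ℕ} (h : (N : Cardinal) ≤ trdeg F A) : ∃ x : Fin N → A, AlgebraicIndependent F x := by
  obtain ⟨s, hs⟩ := exists_isTranscendenceBasis F A
  rw [← hs.cardinalMk_eq_trdeg, ← Cardinal.lift_le.{0}, Cardinal.lift_natCast,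
    ← Cardinal.lift_mk_fin, Cardinal.lift_mk_le'] at h
  obtain ⟨e⟩ := h
  exact ⟨_, hs.1.comp e e.injective⟩

end Trdeg

/-! ### Words in generic matrices -/

/-- The polynomial ring in the entries of a family of `2 × 2` matrices indexed by `Y`. -/
abbrev CoordRing (Y : Type*) : Type _ := MvPolynomial (Y × Fin 2 × Fin 2) ℂ

section Words

variable {Y : Type*} {D : Type*} [CommRing D] [Algebra ℂ D]

/-- Evaluation of polynomials at the entries of a family of matrices. -/
def coordHom (g : Y → Matrix.SpecialLinearGroup (Fin 2) D) : CoordRing Y →ₐ[ℂ] D :=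
  aeval fun i => (g i.1).1 i.2.1 i.2.2

@[simp]
theorem coordHom_X (g : Y → Matrix.SpecialLinearGroup (Fin 2) D) (i : Y × Fin 2 × Fin 2) :
    coordHom g (X i) = (g i.1).1 i.2.1 i.2.2 := by
  simp [coordHom]

def genericMatrix (y : Y) : Matrix (Fin 2) (Fin 2) (CoordRing Y) :=
  Matrix.of fun i j => X (y, i, j)

theorem map_genericMatrix (g : Y → Matrix.SpecialLinearGroup (Fin 2) D) (y : Y) :
    (coordHom g).mapMatrix (genericMatrix y) = (g y).1 := by
  ext i j
  simp [genericMatrix]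

open scoped Classical in
/-- The value of a word at the generic matrices, with inverses replaced by adjugates. -/
def wordMatrix (w : FreeGroup Y) : Matrix (Fin 2) (Fin 2) (CoordRing Y) :=
  (w.toWord.map fun a =>
    bif a.2 then genericMatrix a.1 else (genericMatrix a.1).adjugate).prod

theorem map_wordMatrix (g : Y → Matrix.SpecialLinearGroup (Fin 2) D) (w : FreeGroup Y) :
    (coordHom g).mapMatrix (wordMatrix w) = (FreeGroup.lift g w).1 := by
  classical
  have key : ∀ l : List (Y × Bool), (coordHom g).mapMatrix ((l.map fun a =>
      bif a.2 then genericMatrix a.1 else (genericMatrix a.1).adjugate).prod) =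
      (FreeGroup.lift g (FreeGroup.mk l)).1 := by
    intro l
    rw [FreeGroup.lift_mk]
    induction l with
    | nil => simp
    | cons a l ih =>
      rcases a with ⟨y, b⟩
      rw [List.map_cons, List.prod_cons, map_mul, ih, List.map_cons, List.prod_cons,
        Matrix.SpecialLinearGroup.coe_mul]
      congr 1
      cases b
      · have := (coordHom g).toRingHom.map_adjugate (genericMatrix y)
        simp only [cond_false, Matrix.SpecialLinearGroup.coe_inv]
        rw [← map_genericMatrix]
        exact this
      · exact map_genericMatrix g y
  conv_rhs => rw [← FreeGroup.mk_toWord (x := w)]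
  rw [← key, wordMatrix]

theorem coordHom_wordMatrix (g : Y → Matrix.SpecialLinearGroup (Fin 2) D) (w : FreeGroup Y)
    (i j : Fin 2) : coordHom g (wordMatrix w i j) = (FreeGroup.lift g w).1 i j := by
  rw [← map_wordMatrix]
  rfl

theorem coordHom_det (g : Y → Matrix.SpecialLinearGroup (Fin 2) D) (y : Y) :
    coordHom g (genericMatrix y).det = 1 := by
  have := (coordHom g).toRingHom.map_det (genericMatrix y)
  refine this.trans ?_
  exact (congrArg Matrix.det (map_genericMatrix g y)).trans (g y).2

/-- A scalar matrix of determinant one has an entry with square one, which is `±1` in a domain. This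
makes triviality in `PSL(2)` a polynomial condition. -/
theorem eq_one_or_neg_one_iff {D : Type*} [CommRing D] [IsDomain D]
    (M : Matrix.SpecialLinearGroup (Fin 2) D) :
    M = 1 ∨ M = -1 ↔ M.1 0 1 = 0 ∧ M.1 1 0 = 0 ∧ M.1 0 0 - M.1 1 1 = 0 := by
  constructor
  · rintro (rfl | rfl) <;> simp
  · rintro ⟨h01, h10, h⟩
    have hd := M.2
    rw [Matrix.det_fin_two, h01, sub_eq_zero.mp h] at hd
    rcases mul_self_eq_one_iff.mp (by simpa using hd) with h1 | h1
    · left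
      ext i j
      fin_cases i <;> fin_cases j <;> simp [h01, h10, h1, sub_eq_zero.mp h]
    · right
      ext i j
      fin_cases i <;> fin_cases j <;> simp [h01, h10, h1, sub_eq_zero.mp h]

/-- The equations of the variety of families of matrices of determinant one at which the word `w`
takes a value `±1`. -/
def repIdeal (w : FreeGroup Y) : Ideal (CoordRing Y) :=
  Ideal.span (Set.range (fun y => (genericMatrix y).det - 1) ∪
    {wordMatrix w 0 1, wordMatrix w 1 0, wordMatrix w 0 0 - wordMatrix w 1 1})

theorem repIdeal_le_ker_iff [IsDomain D] (w : FreeGroup Y)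
    (g : Y → Matrix.SpecialLinearGroup (Fin 2) D) :
    repIdeal w ≤ RingHom.ker (coordHom g) ↔ FreeGroup.lift g w = 1 ∨ FreeGroup.lift g w = -1 := by
  rw [eq_one_or_neg_one_iff, repIdeal, Ideal.span_le]
  simp only [Set.union_subset_iff, Set.range_subset_iff, Set.insert_subset_iff,
    Set.singleton_subset_iff, SetLike.mem_coe, RingHom.mem_ker, map_sub, coordHom_wordMatrix,
    coordHom_det, map_one, sub_self, implies_true, true_and]

/-- Together with `repIdeal_le_ker_iff` this identifies `D`-valued points of `CoordRing Y ⧸ repIdeal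
w` with families over the domain `D` at which `w = ±1`. -/
theorem exists_coordHom_eq (w : FreeGroup Y) (φ : CoordRing Y →ₐ[ℂ] D)
    (h : repIdeal w ≤ RingHom.ker φ) :
    ∃ g : Y → Matrix.SpecialLinearGroup (Fin 2) D, coordHom g = φ := by
  refine ⟨fun y => ⟨φ.mapMatrix (genericMatrix y), ?_⟩, ?_⟩
  · have h1 : (genericMatrix y).det - 1 ∈ RingHom.ker φ :=
      h (Ideal.subset_span (Or.inl ⟨y, rfl⟩))
    rw [RingHom.mem_ker, map_sub, map_one, sub_eq_zero] at h1
    exact (φ.toRingHom.map_det (genericMatrix y)).symm.trans h1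
  · ext ⟨y, i, j⟩
    exact coordHom_X _ _

end Words

/-! ### Sign changes -/

section Signs

variable {Y : Type*}

/-- The sign changes `ε` acting on polynomials. -/
def signChange (ε : Y → ℤˣ) : CoordRing Y →ₐ[ℂ] CoordRing Y :=
  aeval fun i => ((ε i.1 : ℤ) : CoordRing Y) * X i

theorem signChange_signChange (ε δ : Y → ℤˣ) (f : CoordRing Y) :
    signChange ε (signChange δ f) = signChange (ε * δ) f := by
  have : (signChange ε).comp (signChange δ) = signChange (ε * δ) := by
    ext i
    simp [signChange]
    ring_nf
  exact DFunLike.congr_fun this f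

theorem signChange_one (f : CoordRing Y) : signChange (1 : Y → ℤˣ) f = f := by
  have : signChange (1 : Y → ℤˣ) = AlgHom.id ℂ _ := by
    ext i
    simp [signChange]
  exact DFunLike.congr_fun this f

theorem signChange_self (ε : Y → ℤˣ) (f : CoordRing Y) : signChange ε (signChange ε f) = f := by
  rw [signChange_signChange, show ε * ε = 1 from funext fun y => Int.units_mul_self _, signChange_one]

/-- The sign changes `ε` acting on families of matrices. -/
def signAct (ε : Y → ℤˣ) (g : Y → Matrix.SpecialLinearGroup (Fin 2) ℂ) :
    Y → Matrix.SpecialLinearGroup (Fin 2) ℂ :=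
  fun y => if ε y = 1 then g y else -g y

theorem coordHom_signAct (ε : Y → ℤˣ) (g : Y → Matrix.SpecialLinearGroup (Fin 2) ℂ)
    (f : CoordRing Y) : coordHom (signAct ε g) f = coordHom g (signChange ε f) := by
  have : coordHom (signAct ε g) = (coordHom g).comp (signChange ε) := by
    ext i
    rcases Int.units_eq_one_or (ε i.1) with h | h <;> simp [signChange, signAct, h]
  exact DFunLike.congr_fun this f

theorem toPSL2C_eq_iff (a b : Matrix.SpecialLinearGroup (Fin 2) ℂ) :
    toPSL2C a = toPSL2C b ↔ b = a ∨ b = -a := by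
  have h : ∀ c : Matrix.SpecialLinearGroup (Fin 2) ℂ,
      c ∈ Subgroup.center (Matrix.SpecialLinearGroup (Fin 2) ℂ) ↔ c = 1 ∨ c = -1 := by
    intro c
    rw [Matrix.SpecialLinearGroup.mem_center_iff]
    constructor
    · rintro ⟨r, -, hr⟩
      rw [eq_one_or_neg_one_iff, ← hr]
      simp
    · rintro (rfl | rfl)
      · exact ⟨1, by simp, by simp⟩
      · refine ⟨-1, by simp, ?_⟩
        ext i j
        fin_cases i <;> fin_cases j <;> simp
  rw [toPSL2C, QuotientGroup.mk'_apply, QuotientGroup.mk'_apply, QuotientGroup.eq, h,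
    inv_mul_eq_iff_eq_mul, inv_mul_eq_iff_eq_mul, mul_one, mul_neg_one]

theorem toPSL2C_eq_one_iff (a : Matrix.SpecialLinearGroup (Fin 2) ℂ) :
    toPSL2C a = 1 ↔ a = 1 ∨ a = -1 := by
  rw [← map_one toPSL2C, eq_comm, toPSL2C_eq_iff]

theorem toPSL2C_surjective : Function.Surjective toPSL2C :=
  QuotientGroup.mk'_surjective _

theorem toPSL2C_signAct (ε : Y → ℤˣ) (g : Y → Matrix.SpecialLinearGroup (Fin 2) ℂ) (y : Y) :
    toPSL2C (signAct ε g y) = toPSL2C (g y) := by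
  refine ((toPSL2C_eq_iff _ _).mpr ?_).symm
  unfold signAct
  split_ifs <;> simp

theorem exists_signAct_eq {g g' : Y → Matrix.SpecialLinearGroup (Fin 2) ℂ}
    (h : ∀ y, toPSL2C (g y) = toPSL2C (g' y)) : ∃ ε, g' = signAct ε g := by
  classical
  refine ⟨fun y => if g' y = g y then 1 else -1, funext fun y => ?_⟩
  by_cases h1 : g' y = g y
  · simp [signAct, h1]
  · have := ((toPSL2C_eq_iff _ _).mp (h y)).resolve_left h1
    simpa [signAct, h1] using this

end Signs

/-! ### Irreducible closed subsets of the representation variety and prime ideals -/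

theorem isClosed_zariskiTopology_iff {S : Type*} (O : Subalgebra ℂ (S → ℂ)) (Z : Set S) :
    @IsClosed S (zariskiTopology O) Z ↔
      ∃ F ⊆ (O : Set (S → ℂ)), Z = {s | ∀ f ∈ F, f s = 0} := by
  rw [← @isOpen_compl_iff _ _ (zariskiTopology O)]
  change Zᶜᶜ ∈ _ ↔ _
  rw [compl_compl]
  rfl

section Bridge

variable {Y : Type*} {w : FreeGroup Y}

/-- The images of the generators under a representation. -/
def RepVariety.gens (ρ : RepVariety {w}) (y : Y) : PSL2C :=
  (show PresentedGroup {w} →* PSL2C from ρ) (PresentedGroup.of y)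

theorem RepVariety.isClosed_iff (Z : Set (RepVariety {w})) :
    IsClosed Z ↔ ∃ F ⊆ (coordinateAlgebraPSL2C Y : Set ((Y → PSL2C) → ℂ)),
      Z = {ρ | ∀ f ∈ F, f ρ.gens = 0} := by
  refine (@isClosed_induced_iff _ _ (zariskiTopology (coordinateAlgebraPSL2C Y)) Z
    RepVariety.gens).trans ⟨?_, ?_⟩
  · rintro ⟨_, h, rfl⟩
    obtain ⟨F, hF, rfl⟩ := (isClosed_zariskiTopology_iff _ _).mp h
    exact ⟨F, hF, rfl⟩
  · rintro ⟨F, hF, rfl⟩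
    exact ⟨_, (isClosed_zariskiTopology_iff _ _).mpr ⟨F, hF, rfl⟩, rfl⟩

theorem RepVariety.exists_lift (ρ : RepVariety {w}) :
    ∃ g : Y → Matrix.SpecialLinearGroup (Fin 2) ℂ, ∀ y, toPSL2C (g y) = ρ.gens y := by
  choose g hg using fun y => toPSL2C_surjective (ρ.gens y)
  exact ⟨g, hg⟩

theorem toPSL2C_lift (g : Y → Matrix.SpecialLinearGroup (Fin 2) ℂ) (v : FreeGroup Y) :
    FreeGroup.lift (fun y => toPSL2C (g y)) v = toPSL2C (FreeGroup.lift g v) := by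
  have : FreeGroup.lift (fun y => toPSL2C (g y)) = toPSL2C.comp (FreeGroup.lift g) := by
    ext y
    simp
  rw [this]
  rfl

theorem RepVariety.apply_eq (ρ : RepVariety {w}) {g : Y → Matrix.SpecialLinearGroup (Fin 2) ℂ}
    (hg : ∀ y, toPSL2C (g y) = ρ.gens y) (v : FreeGroup Y) :
    (show PresentedGroup {w} →* PSL2C from ρ) (PresentedGroup.mk {w} v) =
      toPSL2C (FreeGroup.lift g v) := by
  rw [← toPSL2C_lift, funext hg]
  have : (show PresentedGroup {w} →* PSL2C from ρ).comp (PresentedGroup.mk {w}) =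
      FreeGroup.lift ρ.gens := by
    ext y
    simp [RepVariety.gens]
    rfl
  exact DFunLike.congr_fun this v

theorem RepVariety.repIdeal_le_ker (ρ : RepVariety {w})
    {g : Y → Matrix.SpecialLinearGroup (Fin 2) ℂ} (hg : ∀ y, toPSL2C (g y) = ρ.gens y) :
    repIdeal w ≤ RingHom.ker (coordHom g) := by
  rw [repIdeal_le_ker_iff, ← toPSL2C_eq_one_iff, ← ρ.apply_eq hg,
    PresentedGroup.one_of_mem (Set.mem_singleton w), map_one]

theorem exists_rep_of_repIdeal_le_ker {g : Y → Matrix.SpecialLinearGroup (Fin 2) ℂ}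
    (h : repIdeal w ≤ RingHom.ker (coordHom g)) :
    ∃ ρ : RepVariety {w}, ∀ y, toPSL2C (g y) = ρ.gens y := by
  rw [repIdeal_le_ker_iff, ← toPSL2C_eq_one_iff, ← toPSL2C_lift] at h
  refine ⟨(PresentedGroup.toGroup (f := fun y => toPSL2C (g y)) (rels := {w}) ?_ :
    PresentedGroup {w} →* PSL2C), fun y => ?_⟩
  · rintro _ rfl
    exact h
  · exact (PresentedGroup.toGroup.of (f := fun y => toPSL2C (g y)) _).symm

variable (w) in
/-- The representations that lift to common zeros of the ideal `I`. -/
def repLocus (I : Ideal (CoordRing Y)) : Set (RepVariety {w}) :=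
  {ρ | ∃ g : Y → Matrix.SpecialLinearGroup (Fin 2) ℂ,
    I ≤ RingHom.ker (coordHom g) ∧ ∀ y, toPSL2C (g y) = ρ.gens y}

theorem repLocus_anti {I J : Ideal (CoordRing Y)} (h : I ≤ J) : repLocus w J ⊆ repLocus w I :=
  fun _ ⟨g, hg, hρ⟩ => ⟨g, h.trans hg, hρ⟩

theorem repLocus_repIdeal : repLocus w (repIdeal w) = Set.univ :=
  Set.eq_univ_of_forall fun ρ =>
    let ⟨g, hg⟩ := ρ.exists_lift
    ⟨g, ρ.repIdeal_le_ker hg, hg⟩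

/-- Functions on `PSL(2, ℂ)^Y` from polynomials that are invariant under sign changes. -/
theorem exists_mem_coordinateAlgebra {N : CoordRing Y} (hN : ∀ ε, signChange ε N = N) :
    ∃ f ∈ coordinateAlgebraPSL2C Y, ∀ g : Y → Matrix.SpecialLinearGroup (Fin 2) ℂ,
      f (fun y => toPSL2C (g y)) = coordHom g N := by
  choose s hs using toPSL2C_surjective
  have key : ∀ g : Y → Matrix.SpecialLinearGroup (Fin 2) ℂ,
      coordHom (fun y => s (toPSL2C (g y))) N = coordHom g N := by
    intro g
    obtain ⟨ε, hε⟩ := exists_signAct_eq (g := g) (g' := fun y => s (toPSL2C (g y)))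
      (fun y => (hs _).symm)
    rw [hε, coordHom_signAct, hN]
  exact ⟨fun q => coordHom (fun y => s (q y)) N, ⟨N, fun g => key g⟩, key⟩

variable [Fintype Y]

/-- The Nullstellensatz for ideals containing the equations of the representation variety. -/
theorem mem_radical_of_forall_coordHom_eq_zero {I : Ideal (CoordRing Y)} (hI : repIdeal w ≤ I)
    {f : CoordRing Y} (hf : ∀ g : Y → Matrix.SpecialLinearGroup (Fin 2) ℂ,
      I ≤ RingHom.ker (coordHom g) → coordHom g f = 0) : f ∈ I.radical := by
  rw [← MvPolynomial.vanishingIdeal_zeroLocus_eq_radical (K := ℂ)]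
  intro x hx
  have hx' : I ≤ RingHom.ker (aeval x : CoordRing Y →ₐ[ℂ] ℂ) := fun q hq => hx q hq
  obtain ⟨g, hg⟩ := exists_coordHom_eq w (aeval x : CoordRing Y →ₐ[ℂ] ℂ) (hI.trans hx')
  rw [← hg] at hx' ⊢
  exact hf g hx'

theorem mem_of_forall_coordHom_eq_zero {P : Ideal (CoordRing Y)} [hP : P.IsPrime]
    (hI : repIdeal w ≤ P) {f : CoordRing Y}
    (hf : ∀ g : Y → Matrix.SpecialLinearGroup (Fin 2) ℂ,
      P ≤ RingHom.ker (coordHom g) → coordHom g f = 0) : f ∈ P :=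
  hP.radical ▸ mem_radical_of_forall_coordHom_eq_zero hI hf

/-- A finite quotient map is closed. If no sign change of `g` is a zero of `P`, prime avoidance
yields `f ∈ P` that vanishes at none of them; the product of the sign changes of `f` descends to
`PSL(2, ℂ)^Y` and separates `g` from the locus. -/
theorem isClosed_repLocus (P : Ideal (CoordRing Y)) : IsClosed (repLocus w P) := by
  classical
  rw [RepVariety.isClosed_iff]
  refine ⟨{f | f ∈ coordinateAlgebraPSL2C Y ∧ ∀ ρ ∈ repLocus w P, f ρ.gens = 0},
    fun f hf => hf.1, Set.Subset.antisymm (fun ρ hρ f hf => hf.2 ρ hρ) fun ρ hρ => ?_⟩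
  obtain ⟨g, hg⟩ := ρ.exists_lift
  by_contra hcon
  have hne : ∀ ε : Y → ℤˣ, ¬ P ≤ RingHom.ker (coordHom (signAct ε g)) := fun ε h =>
    hcon ⟨_, h, fun y => (toPSL2C_signAct ε g y).trans (hg y)⟩
  have hav : ¬ ((P : Set (CoordRing Y)) ⊆ ⋃ ε ∈ ((Finset.univ : Finset (Y → ℤˣ)) : Set (Y → ℤˣ)),
      (RingHom.ker (coordHom (signAct ε g)) : Set (CoordRing Y))) := by
    rw [Ideal.subset_union_prime 1 1 fun _ _ _ _ => RingHom.ker_isPrime _]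
    rintro ⟨ε, -, h⟩
    exact hne ε h
  obtain ⟨f, hfP, hf⟩ := Set.not_subset.mp hav
  have hf' : ∀ ε, coordHom g (signChange ε f) ≠ 0 := by
    intro ε h
    apply hf
    simp only [Set.mem_iUnion]
    exact ⟨ε, by simp, by simpa [RingHom.mem_ker, coordHom_signAct] using h⟩
  obtain ⟨F, hF, hFN⟩ := exists_mem_coordinateAlgebra (N := ∏ ε : Y → ℤˣ, signChange ε f) (by
    intro ε
    rw [map_prod]
    simp only [signChange_signChange]
    exact Fintype.prod_equiv (Equiv.mulLeft ε) _ _ fun _ => rfl)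
  have h0 := hρ F ⟨hF, by
    rintro σ ⟨g', hg', hσ⟩
    rw [← funext hσ, hFN, map_prod]
    exact Finset.prod_eq_zero (Finset.mem_univ 1) (by rw [signChange_one]; exact hg' hfP)⟩
  rw [← funext hg, hFN, map_prod, Finset.prod_eq_zero_iff] at h0
  obtain ⟨ε, -, hε⟩ := h0
  exact hf' ε hε

theorem repLocus_nonempty {P : Ideal (CoordRing Y)} [hP : P.IsPrime] (hI : repIdeal w ≤ P) :
    (repLocus w P).Nonempty := by
  by_contra hcon
  refine hP.ne_top (P.eq_top_iff_one.mpr (mem_of_forall_coordHom_eq_zero hI fun g hg => ?_))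
  obtain ⟨ρ, hρ⟩ := exists_rep_of_repIdeal_le_ker (hI.trans hg)
  exact (hcon ⟨ρ, g, hg, hρ⟩).elim

theorem isIrreducible_repLocus {P : Ideal (CoordRing Y)} [hP : P.IsPrime] (hI : repIdeal w ≤ P) :
    IsIrreducible (repLocus w P) := by
  refine ⟨repLocus_nonempty hI, isPreirreducible_iff_isClosed_union_isClosed.mpr ?_⟩
  intro Z₁ Z₂ h₁ h₂ hsub
  obtain ⟨F₁, hF₁, rfl⟩ := (RepVariety.isClosed_iff _).mp h₁
  obtain ⟨F₂, hF₂, rfl⟩ := (RepVariety.isClosed_iff _).mp h₂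
  by_contra! hcon
  simp only [Set.not_subset, Set.mem_ofPred_eq, not_forall] at hcon
  obtain ⟨⟨ρ₁, ⟨g₁, hg₁, hρ₁⟩, f₁, hf₁, hn₁⟩, ρ₂, ⟨g₂, hg₂, hρ₂⟩, f₂, hf₂, hn₂⟩ := hcon
  obtain ⟨q₁, hq₁⟩ := hF₁ hf₁
  obtain ⟨q₂, hq₂⟩ := hF₂ hf₂
  have hmem : q₁ * q₂ ∈ P := by
    refine mem_of_forall_coordHom_eq_zero hI fun g hg => ?_
    obtain ⟨ρ, hρ⟩ := exists_rep_of_repIdeal_le_ker (hI.trans hg)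
    have e₁ : coordHom g q₁ = f₁ ρ.gens := by rw [← funext hρ, hq₁]; rfl
    have e₂ : coordHom g q₂ = f₂ ρ.gens := by rw [← funext hρ, hq₂]; rfl
    rw [map_mul, e₁, e₂]
    rcases hsub ⟨g, hg, hρ⟩ with h | h
    · rw [h f₁ hf₁, zero_mul]
    · rw [h f₂ hf₂, mul_zero]
  rcases hP.mem_or_mem hmem with h | h
  · exact hn₁ (by rw [← funext hρ₁, hq₁]; exact hg₁ h)
  · exact hn₂ (by rw [← funext hρ₂, hq₂]; exact hg₂ h)

/-- Incomparability for the finite quotient: primes with the same locus may differ by a sign change,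
but cannot be strictly nested. -/
theorem repLocus_ne_of_lt {P Q : Ideal (CoordRing Y)} [hP : P.IsPrime] (hI : repIdeal w ≤ P)
    (hPQ : P < Q) : repLocus w P ≠ repLocus w Q := by
  classical
  intro heq
  -- Otherwise pick for each `ε` some `f ε ∈ Q` violating this. Every zero of `P` has a sign change
  -- that is a zero of `Q`, so the product of the `signChange ε (f ε)` vanishes on the zeros of `P`
  -- and lies in `P`, which is prime.
  have key : ∃ ε : Y → ℤˣ, ∀ f ∈ Q, signChange ε f ∈ P := by
    by_contra! hcon
    choose f hfQ hfP using hcon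
    have hmem : ∏ ε : Y → ℤˣ, signChange ε (f ε) ∈ P := by
      refine mem_of_forall_coordHom_eq_zero hI fun g hg => ?_
      obtain ⟨ρ, hρ⟩ := exists_rep_of_repIdeal_le_ker (hI.trans hg)
      obtain ⟨g', hg', hρ'⟩ := heq ▸ (show ρ ∈ repLocus w P from ⟨g, hg, hρ⟩)
      obtain ⟨ε, rfl⟩ := exists_signAct_eq fun y => (hρ y).trans (hρ' y).symm
      rw [map_prod]
      exact Finset.prod_eq_zero (Finset.mem_univ ε)
        ((coordHom_signAct ε g (f ε)).symm.trans (hg' (hfQ ε)))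
    obtain ⟨ε, -, hε⟩ := (hP.prod_mem_iff).mp hmem
    exact hfP ε hε
  obtain ⟨ε, hε⟩ := key
  -- Applying `ε` twice maps `Q` into `P ≤ Q` and then into `P`, but is the identity.
  refine hPQ.not_ge fun f hf => ?_
  rw [← signChange_self ε f]
  exact hε _ (hPQ.le (hε f hf))

/-- Add to `I` the equations of `C`. The loci of the finitely many minimal primes of the resulting
ideal cover `C`, so one of them contains the irreducible set `C`. With `I = repIdeal w` this gives
surjectivity of `primeLocus`, with `I` prime it gives going-up. -/
theorem exists_prime_repLocus_eq {I : Ideal (CoordRing Y)} {C : Set (RepVariety {w})}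
    (hC : IsClosed C) (hirr : IsIrreducible C)
    (hCI : C ⊆ repLocus w I) :
    ∃ Q : Ideal (CoordRing Y), Q.IsPrime ∧ I ≤ Q ∧ repLocus w Q = C := by
  classical
  obtain ⟨F, hF, hCF⟩ := (RepVariety.isClosed_iff _).mp hC
  let J : Ideal (CoordRing Y) := I ⊔ Ideal.span {q | ∃ f ∈ F,
    ∀ g : Y → Matrix.SpecialLinearGroup (Fin 2) ℂ, f (fun y => toPSL2C (g y)) = coordHom g q}
  have hJ : ∀ (ρ : RepVariety {w}) (g : Y → Matrix.SpecialLinearGroup (Fin 2) ℂ),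
      (∀ y, toPSL2C (g y) = ρ.gens y) →
      (J ≤ RingHom.ker (coordHom g) ↔ I ≤ RingHom.ker (coordHom g) ∧ ρ ∈ C) := by
    intro ρ g hρ
    rw [sup_le_iff, Ideal.span_le, hCF]
    refine and_congr_right fun _ => ⟨fun h f hf => ?_, ?_⟩
    · obtain ⟨q, hq⟩ := hF hf
      rw [← funext hρ, hq]
      exact h ⟨f, hf, hq⟩
    · rintro h q ⟨f, hf, hq⟩
      rw [SetLike.mem_coe, RingHom.mem_ker, ← hq, funext hρ]
      exact h f hf
  have hfin : (J.minimalPrimes).Finite := Ideal.finite_minimalPrimes_of_isNoetherianRing _ J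
  have hcover : C ⊆ ⋃₀ ((fun Q => repLocus w Q) '' J.minimalPrimes) := by
    intro ρ hρ
    obtain ⟨g, hg, hgρ⟩ := hCI hρ
    have hle := (hJ ρ g hgρ).mpr ⟨hg, hρ⟩
    have := RingHom.ker_isPrime (coordHom g)
    obtain ⟨Q, hQ, hQle⟩ := Ideal.exists_minimalPrimes_le hle
    exact ⟨_, ⟨Q, hQ, rfl⟩, g, hQle, hgρ⟩
  obtain ⟨_, hz, hCz⟩ := isIrreducible_iff_sUnion_isClosed.mp hirr
    (hfin.image _).toFinset (by
      intro z hz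
      simp only [Set.Finite.mem_toFinset, Set.mem_image] at hz
      obtain ⟨Q, -, rfl⟩ := hz
      exact isClosed_repLocus Q) (by simpa using hcover)
  simp only [Set.Finite.mem_toFinset, Set.mem_image] at hz
  obtain ⟨Q, hQ, rfl⟩ := hz
  refine ⟨Q, hQ.1.1, le_sup_left.trans hQ.1.2, Set.Subset.antisymm ?_ hCz⟩
  rintro ρ ⟨g, hg, hgρ⟩
  exact ((hJ ρ g hgρ).mp (hQ.1.2.trans hg)).2

/-- The irreducible closed set of representations defined by a prime ideal. -/
def primeLocus (P : (PrimeSpectrum.zeroLocus (repIdeal w : Set (CoordRing Y)))ᵒᵈ) :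
    TopologicalSpace.IrreducibleCloseds (RepVariety {w}) :=
  ⟨repLocus w (OrderDual.ofDual P).1.asIdeal, isIrreducible_repLocus (OrderDual.ofDual P).2,
    isClosed_repLocus _⟩

theorem primeLocus_strictMono : StrictMono (primeLocus (w := w)) := by
  intro P Q hPQ
  have h : (OrderDual.ofDual Q).1.asIdeal < (OrderDual.ofDual P).1.asIdeal := hPQ
  refine lt_of_le_of_ne (repLocus_anti h.le) fun heq => ?_
  exact repLocus_ne_of_lt (OrderDual.ofDual Q).2 h
    (congrArg TopologicalSpace.IrreducibleCloseds.carrier heq).symm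

/-- `primeLocus` need not be injective, since sign changes of a prime have the same locus, but it is
strictly monotone and chains lift along it. -/
theorem topologicalKrullDim_repVariety :
    topologicalKrullDim (RepVariety {w}) = ringKrullDim (CoordRing Y ⧸ repIdeal w) := by
  rw [ringKrullDim_quotient, topologicalKrullDim, ← Order.krullDim_orderDual, eq_comm]
  refine Order.krullDim_eq_of_goingUp
    (fun P => OrderDual.toDual (primeLocus (w := w) (OrderDual.toDual P))) ?_ ?_ ?_
  · exact fun P Q h => primeLocus_strictMono (OrderDual.toDual_lt_toDual.mpr h)
  · intro C
    obtain ⟨Q, hQ, hle, h⟩ := exists_prime_repLocus_eq (I := repIdeal w)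
      (OrderDual.ofDual C).isClosed
      (OrderDual.ofDual C).isIrreducible (by rw [repLocus_repIdeal]; exact Set.subset_univ _)
    exact ⟨⟨⟨Q, hQ⟩, hle⟩, congrArg OrderDual.toDual (TopologicalSpace.IrreducibleCloseds.ext h)⟩
  · intro P C hPC
    have hlt : OrderDual.ofDual C < primeLocus (w := w) (OrderDual.toDual P) := hPC
    obtain ⟨Q, hQ, hle, h⟩ := exists_prime_repLocus_eq (I := P.1.asIdeal)
      (OrderDual.ofDual C).isClosed
      (OrderDual.ofDual C).isIrreducible hlt.le
    refine ⟨⟨⟨Q, hQ⟩, P.2.trans hle⟩, lt_of_le_of_ne hle ?_,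
      congrArg OrderDual.toDual (TopologicalSpace.IrreducibleCloseds.ext h)⟩
    intro heq
    refine hlt.ne (TopologicalSpace.IrreducibleCloseds.ext ?_)
    rw [← h, heq]
    rfl

end Bridge

/-! ### Dimension in terms of generic representations -/

section Generic

universe u

variable {Y : Type u} [Fintype Y] {w : FreeGroup Y}

/-- A lower bound for the dimension of the closure of a generic representation. -/
theorem natCast_le_ringKrullDim_quotient_ker {L : Type*} [CommRing L] [IsDomain L] [Algebra ℂ L]
    (g : Y → Matrix.SpecialLinearGroup (Fin 2) L) {ι : Type*} [Fintype ι] {x : ι → L}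
    (hx : AlgebraicIndependent ℂ x) (hmem : ∀ i, x i ∈ (coordHom g).range) :
    ((Fintype.card ι : ℕ) : WithBot ℕ∞) ≤
      ringKrullDim (CoordRing Y ⧸ RingHom.ker (coordHom g)) := by
  have hprime : (RingHom.ker (coordHom g)).IsPrime := RingHom.ker_isPrime _
  rw [natCast_le_ringKrullDim_iff_le_trdeg ℂ]
  choose q hq using hmem
  have hind : AlgebraicIndependent ℂ
      (fun i => (Ideal.Quotient.mk (RingHom.ker (coordHom g)) (q i))) := by
    refine AlgebraicIndependent.of_comp (Ideal.kerLiftAlg (coordHom g)) ?_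
    convert hx using 1
    ext i
    exact hq i
  simpa using hind.lift_cardinalMk_le_trdeg

theorem natCast_le_topologicalKrullDim_of_generic {L : Type*} [CommRing L] [IsDomain L]
    [Algebra ℂ L] {g : Y → Matrix.SpecialLinearGroup (Fin 2) L}
    (hg : FreeGroup.lift g w = 1 ∨ FreeGroup.lift g w = -1) {ι : Type*} [Fintype ι] {x : ι → L}
    (hx : AlgebraicIndependent ℂ x) (hmem : ∀ i, x i ∈ (coordHom g).range) :
    ((Fintype.card ι : ℕ) : WithBot ℕ∞) ≤ topologicalKrullDim (RepVariety {w}) := by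
  rw [topologicalKrullDim_repVariety]
  refine (natCast_le_ringKrullDim_quotient_ker g hx hmem).trans ?_
  exact ringKrullDim_le_of_surjective (Ideal.Quotient.factor ((repIdeal_le_ker_iff w g).mpr hg))
    (Ideal.Quotient.factor_surjective _)

theorem exists_generic_of_natCast_le_topologicalKrullDim {N : ℕ}
    (h : (N : WithBot ℕ∞) ≤ topologicalKrullDim (RepVariety {w})) :
    ∃ (L : Type u) (_ : Field L) (_ : Algebra ℂ L) (_ : IsAlgClosed L)
      (g : Y → Matrix.SpecialLinearGroup (Fin 2) L) (x : Fin N → L),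
      (FreeGroup.lift g w = 1 ∨ FreeGroup.lift g w = -1) ∧ AlgebraicIndependent ℂ x ∧
        ∀ i, x i ∈ (coordHom g).range := by
  rw [topologicalKrullDim_repVariety, ringKrullDim_quotient, Order.le_krullDim_iff] at h
  obtain ⟨l, hl⟩ := h
  -- The smallest prime of the chain; the tautological family over an algebraic closure of the
  -- fraction field of its quotient is the required point.
  let P := l.head.1.asIdeal
  have hP : (N : WithBot ℕ∞) ≤ ringKrullDim (CoordRing Y ⧸ P) := by
    rw [ringKrullDim_quotient, Order.le_krullDim_iff]
    refine ⟨⟨l.length, fun i => ⟨(l i).1, ?_⟩, fun i => l.step i⟩, hl⟩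
    exact (l.head_le i : l.head ≤ l i)
  rw [natCast_le_ringKrullDim_iff_le_trdeg ℂ] at hP
  obtain ⟨x, hx⟩ := exists_algebraicIndependent_of_le_trdeg hP
  let L := AlgebraicClosure (FractionRing (CoordRing Y ⧸ P))
  let φ : (CoordRing Y ⧸ P) →ₐ[ℂ] L :=
    (Algebra.ofId (FractionRing (CoordRing Y ⧸ P)) L).restrictScalars ℂ
    |>.comp (Algebra.algHom ℂ (CoordRing Y ⧸ P) (FractionRing (CoordRing Y ⧸ P)))
  have hφ : Function.Injective φ :=
    (algebraMap (FractionRing (CoordRing Y ⧸ P)) L).injective.comp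
      (IsFractionRing.injective (CoordRing Y ⧸ P) (FractionRing (CoordRing Y ⧸ P)))
  have hker : repIdeal w ≤ RingHom.ker (φ.comp (Ideal.Quotient.mkₐ ℂ P)) := by
    intro f hf
    have : Ideal.Quotient.mkₐ ℂ P f = 0 := Ideal.Quotient.eq_zero_iff_mem.mpr (l.head.2 hf)
    rw [RingHom.mem_ker, AlgHom.comp_apply, this, map_zero]
  obtain ⟨g, hg⟩ := exists_coordHom_eq w _ hker
  refine ⟨L, inferInstance, inferInstance, inferInstance, g, fun i => φ (x i), ?_, ?_, fun i => ?_⟩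
  · rwa [← repIdeal_le_ker_iff, hg]
  · exact hx.map' hφ
  · rw [hg]
    obtain ⟨q, hq⟩ := Ideal.Quotient.mk_surjective (x i)
    exact ⟨q, congrArg φ hq⟩

/-- A chain of irreducible closed sets inside the locus of `g` can be prolonged by the whole space.
-/
theorem natCast_succ_le_topologicalKrullDim_of_preirreducibleSpace
    [PreirreducibleSpace (RepVariety {w})] {L : Type*} [CommRing L] [IsDomain L]
    [Algebra ℂ L] {g : Y → Matrix.SpecialLinearGroup (Fin 2) L}
    (hg : FreeGroup.lift g w = 1 ∨ FreeGroup.lift g w = -1) {ι : Type*} [Fintype ι] {x : ι → L}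
    (hx : AlgebraicIndependent ℂ x) (hmem : ∀ i, x i ∈ (coordHom g).range)
    (hne : repLocus w (RingHom.ker (coordHom g)) ≠ Set.univ) :
    ((Fintype.card ι + 1 : ℕ) : WithBot ℕ∞) ≤ topologicalKrullDim (RepVariety {w}) := by
  have h := natCast_le_ringKrullDim_quotient_ker g hx hmem
  rw [ringKrullDim_quotient, Order.le_krullDim_iff] at h
  obtain ⟨l, hl⟩ := h
  have hI := (repIdeal_le_ker_iff w g).mpr hg
  let j : PrimeSpectrum.zeroLocus (RingHom.ker (coordHom g) : Set (CoordRing Y)) →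
      PrimeSpectrum.zeroLocus (repIdeal w : Set (CoordRing Y)) := fun P => ⟨P.1, hI.trans P.2⟩
  have hj : StrictMono j := fun _ _ h => h
  let r : LTSeries (PrimeSpectrum.zeroLocus (repIdeal w : Set (CoordRing Y)))ᵒᵈ :=
    RelSeries.reverse (LTSeries.map l j hj)
  let l' := LTSeries.map r primeLocus primeLocus_strictMono
  have hne' : Nonempty (RepVariety {w}) := by
    obtain ⟨ρ, -⟩ := repLocus_nonempty (w := w) (P := l.head.1.asIdeal) (hI.trans l.head.2)
    exact ⟨ρ⟩
  have hirr : IsIrreducible (Set.univ : Set (RepVariety {w})) :=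
    have : IrreducibleSpace (RepVariety {w}) := { toNonempty := hne' }
    IrreducibleSpace.isIrreducible_univ _
  have hlt : l'.last < ⟨Set.univ, hirr, isClosed_univ⟩ := by
    refine lt_of_le_of_ne (Set.subset_univ _) fun heq => hne ?_
    have h1 := congrArg TopologicalSpace.IrreducibleCloseds.carrier heq
    refine Set.eq_univ_of_univ_subset (h1.symm.subset.trans ?_)
    have h2 : l'.last = primeLocus (OrderDual.toDual (j l.head)) := by
      rw [LTSeries.last_map]
      exact congrArg primeLocus (RelSeries.last_reverse (LTSeries.map l j hj))
    rw [h2]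
    exact repLocus_anti l.head.2
  exact Order.le_krullDim_iff.mpr ⟨l'.snoc _ hlt, congrArg (· + 1) hl⟩

end Generic

/-! ### Matrices of determinant one over fields -/

section MatrixLemmas

theorem Matrix.SpecialLinearGroup.sq_fin_two {D : Type*} [CommRing D]
    (h : Matrix.SpecialLinearGroup (Fin 2) D) :
    h.1 * h.1 = h.1.trace • h.1 - 1 := by
  have hd := h.2
  rw [Matrix.det_fin_two] at hd
  ext i j
  fin_cases i <;> fin_cases j <;>
    simp [Matrix.mul_apply, Fin.sum_univ_two, Matrix.trace_fin_two] <;> grind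

/-- By Cayley–Hamilton, powers of `h` are combinations of `h` and `1` with coefficients polynomial
in the trace. -/
theorem Matrix.SpecialLinearGroup.exists_pow_eq {D : Type*} [CommRing D]
    (h : Matrix.SpecialLinearGroup (Fin 2) D) (A : Subring D) (ht : h.1.trace ∈ A) (k : ℕ) :
    ∃ α ∈ A, ∃ β ∈ A, h.1 ^ k = α • h.1 + β • (1 : Matrix (Fin 2) (Fin 2) D) := by
  induction k with
  | zero => exact ⟨0, A.zero_mem, 1, A.one_mem, by simp⟩
  | succ k ih =>
    obtain ⟨α, hα, β, hβ, hk⟩ := ih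
    refine ⟨α * h.1.trace + β, A.add_mem (A.mul_mem hα ht) hβ, -α, A.neg_mem hα, ?_⟩
    rw [pow_succ, hk, add_mul, smul_mul_assoc, h.sq_fin_two, smul_mul_assoc, one_mul]
    module

theorem Matrix.SpecialLinearGroup.det_smul_add_smul_one {D : Type*} [CommRing D]
    (M : Matrix.SpecialLinearGroup (Fin 2) D) (α β : D) :
    (α • M.1 + β • (1 : Matrix (Fin 2) (Fin 2) D)).det = α ^ 2 + α * β * M.1.trace + β ^ 2 := by
  have hd := M.2
  rw [Matrix.det_fin_two] at hd
  simp [Matrix.det_fin_two, Matrix.trace_fin_two]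
  linear_combination α ^ 2 * hd

variable {K : Type*} [Field K] [IsAlgClosed K] [CharZero K]

theorem IsAlgClosed.exists_mul_eq_one_and_add_eq (t : K) : ∃ a b : K, a * b = 1 ∧ a + b = t := by
  obtain ⟨s, hs⟩ := IsAlgClosed.exists_pow_nat_eq (t ^ 2 - 4) (n := 2) (by norm_num)
  refine ⟨(t + s) / 2, (t - s) / 2, ?_, by ring⟩
  linear_combination (-1 / 4) * hs

/-- Up to sign, elements of `SL(2)` over an algebraically closed field of characteristic zero have
`p`-th roots. -/
theorem Matrix.SpecialLinearGroup.exists_pow_eq_or_eq_neg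
    (M : Matrix.SpecialLinearGroup (Fin 2) K) {p : ℕ} (hp : p ≠ 0) :
    ∃ h : Matrix.SpecialLinearGroup (Fin 2) K, h ^ p = M ∨ h ^ p = -M := by
  obtain ⟨a, b, hab, ht⟩ := IsAlgClosed.exists_mul_eq_one_and_add_eq M.1.trace
  have hsq := M.sq_fin_two
  rw [← ht] at hsq
  by_cases hne : a = b
  -- Here `a = ±1` and `a • M = 1 + N` with `N ^ 2 = 0`, so `1 + N / p` is a `p`-th root of `a • M`.
  · subst hne
    have hp' : (p : K) ≠ 0 := Nat.cast_ne_zero.mpr hp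
    have hd : ((a / p) • M.1 + (1 - 1 / p : K) • (1 : Matrix (Fin 2) (Fin 2) K)).det = 1 := by
      rw [M.det_smul_add_smul_one, ← ht]
      field_simp
      linear_combination (2 * (p : K) - 1) * hab
    have hpow : ∀ k : ℕ, ((a / p) • M.1 + (1 - 1 / p : K) • (1 : Matrix (Fin 2) (Fin 2) K)) ^ k =
        (k * a / p) • M.1 + (1 - k / p : K) • (1 : Matrix (Fin 2) (Fin 2) K) := by
      intro k
      induction k with
      | zero => simp
      | succ k ih =>
        rw [pow_succ, ih, add_mul, mul_add, mul_add, smul_mul_smul_comm, smul_mul_smul_comm,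
          smul_mul_smul_comm, smul_mul_smul_comm, hsq, mul_one, one_mul, mul_one]
        match_scalars
        · field_simp
          linear_combination (2 * (k : K) * a) * hab
        · field_simp
          linear_combination (-k : K) * hab
    refine ⟨⟨_, hd⟩, ?_⟩
    have h1 := hpow p
    rw [mul_div_right_comm, div_self hp', one_mul, sub_self, zero_smul, add_zero] at h1
    rcases mul_self_eq_one_iff.mp hab with ha | ha
    · left
      exact Subtype.ext ((Matrix.SpecialLinearGroup.coe_pow _ _).trans (h1.trans (by simp [ha])))
    · right
      exact Subtype.ext ((Matrix.SpecialLinearGroup.coe_pow _ _).trans (h1.trans (by simp [ha])))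
  · obtain ⟨c, hc⟩ := IsAlgClosed.exists_pow_nat_eq a (n := p) (Nat.pos_of_ne_zero hp)
    have ha0 : a ≠ 0 := left_ne_zero_of_mul_eq_one hab
    have hc0 : c ≠ 0 := by
      rintro rfl
      exact ha0 (by rw [← hc, zero_pow hp])
    have hs : a - b ≠ 0 := sub_ne_zero.mpr hne
    have hb : b = (c⁻¹) ^ p := by
      rw [inv_pow, hc]
      exact eq_inv_of_mul_eq_one_right hab
    -- The linear polynomial taking the eigenvalues `a`, `b` of `M` to `p`-th roots of them. Its
    -- `p`-th power, reduced modulo the characteristic polynomial, fixes both eigenvalues, so it is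
    -- the identity polynomial.
    obtain ⟨α, β, h1, h2⟩ : ∃ α β : K, α * a + β = c ∧ α * b + β = c⁻¹ :=
      ⟨(c - c⁻¹) / (a - b), c - (c - c⁻¹) / (a - b) * a, by ring, by field_simp; ring⟩
    have hd : (α • M.1 + β • (1 : Matrix (Fin 2) (Fin 2) K)).det = 1 := by
      rw [M.det_smul_add_smul_one, ← ht, ← mul_inv_cancel₀ hc0, ← h2]
      linear_combination (-α ^ 2) * hab + (α * b + β) * h1
    have hpow : ∀ k : ℕ, ∃ α' β' : K, α' * a + β' = c ^ k ∧ α' * b + β' = c⁻¹ ^ k ∧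
        (α • M.1 + β • (1 : Matrix (Fin 2) (Fin 2) K)) ^ k =
          α' • M.1 + β' • (1 : Matrix (Fin 2) (Fin 2) K) := by
      intro k
      induction k with
      | zero => exact ⟨0, 1, by simp, by simp, by simp⟩
      | succ k ih =>
        obtain ⟨α', β', e1, e2, e3⟩ := ih
        refine ⟨α' * α * (a + b) + α' * β + β' * α, β' * β - α' * α, ?_, ?_, ?_⟩
        · rw [pow_succ, ← e1, ← h1]
          linear_combination α' * α * hab
        · rw [pow_succ, ← e2, ← h2]
          linear_combination α' * α * hab
        · rw [pow_succ, e3, add_mul, mul_add, mul_add, smul_mul_smul_comm, smul_mul_smul_comm,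
            smul_mul_smul_comm, smul_mul_smul_comm, hsq, mul_one, one_mul, mul_one]
          module
    obtain ⟨α', β', e1, e2, e3⟩ := hpow p
    rw [hc] at e1
    rw [← hb] at e2
    have hα' : α' = 1 := by
      have : (α' - 1) * (a - b) = 0 := by linear_combination e1 - e2
      exact sub_eq_zero.mp ((mul_eq_zero.mp this).resolve_right hs)
    have hβ' : β' = 0 := by
      rw [hα'] at e1
      linear_combination e1
    refine ⟨⟨_, hd⟩, Or.inl (Subtype.ext ?_)⟩
    exact (Matrix.SpecialLinearGroup.coe_pow _ _).trans (e3.trans (by simp [hα', hβ']))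

theorem Matrix.SpecialLinearGroup.trace_pow_fin_two {D : Type*} [CommRing D]
    (h : Matrix.SpecialLinearGroup (Fin 2) D) {a b : D} (hab : a * b = 1)
    (ht : a + b = h.1.trace) (k : ℕ) : (h.1 ^ k).trace = a ^ k + b ^ k := by
  suffices (h.1 ^ k).trace = a ^ k + b ^ k ∧ (h.1 ^ (k + 1)).trace = a ^ (k + 1) + b ^ (k + 1) from
    this.1
  induction k with
  | zero => simp [ht]; norm_num
  | succ k ih =>
    refine ⟨ih.2, ?_⟩
    rw [pow_succ, pow_succ, mul_assoc, h.sq_fin_two, mul_sub, mul_smul_comm, ← pow_succ, mul_one,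
      Matrix.trace_sub, Matrix.trace_smul, ih.1, ih.2, ← ht, smul_eq_mul]
    linear_combination (a ^ k + b ^ k) * hab

/-- The trace of `h` is algebraic as soon as the trace of a power of `h` is. -/
theorem Matrix.SpecialLinearGroup.isAlgebraic_trace {B : Type*} [CommRing B] [IsDomain B]
    [Algebra B K] (h : Matrix.SpecialLinearGroup (Fin 2) K) {p : ℕ} (hp : p ≠ 0)
    (ht : IsAlgebraic B (h.1 ^ p).trace) : IsAlgebraic B h.1.trace := by
  obtain ⟨a, b, hab, hab'⟩ := IsAlgClosed.exists_mul_eq_one_and_add_eq h.1.trace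
  have htr := h.trace_pow_fin_two hab hab' p
  have hb : b = a⁻¹ := eq_inv_of_mul_eq_one_right hab
  let A := Subalgebra.algebraicClosure B K
  -- The eigenvalue `a ^ p` of `h ^ p` is a root of `T ^ 2 - tr(h ^ p) T + 1`.
  have h1 : IsIntegral A (a ^ p) := by
    refine ⟨Polynomial.X ^ 2 - Polynomial.C ⟨_, ht⟩ * Polynomial.X + Polynomial.C 1,
      by monicity!, ?_⟩
    have : a ^ p * b ^ p = 1 := by rw [← mul_pow, hab, one_pow]
    simp
    change (a ^ p) ^ 2 - (h.1 ^ p).trace * a ^ p + 1 = 0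
    rw [htr]
    linear_combination -this
  have h2 : IsAlgebraic B a := (h1.isAlgebraic.restrictScalars B).of_pow (Nat.pos_of_ne_zero hp)
  rw [← hab', hb]
  exact h2.add h2.inv

end MatrixLemmas

/-! ### Transcendence degrees of generic representations -/

section Triples

variable {X : Type*} {A : Type*} [CommRing A] [IsDomain A] [Algebra ℂ A]

open scoped Classical in
/-- Three of the four entries of each matrix, over which the remaining entry is algebraic. -/
def entryTriple (g : X → Matrix.SpecialLinearGroup (Fin 2) A) (i : X × Fin 3) : A :=
  ![if (g i.1).1 0 0 = 0 then (g i.1).1 1 1 else (g i.1).1 0 0, (g i.1).1 0 1, (g i.1).1 1 0] i.2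

theorem isAlgebraic_adjoin_entryTriple {g : X → Matrix.SpecialLinearGroup (Fin 2) A}
    (hg : Function.Surjective (coordHom g)) :
    Algebra.IsAlgebraic (Algebra.adjoin ℂ (Set.range (entryTriple g))) A := by
  set B := Algebra.adjoin ℂ (Set.range (entryTriple g)) with hB
  have hmem : ∀ i, IsAlgebraic B (entryTriple g i) := fun i =>
    isAlgebraic_algebraMap (⟨_, Algebra.subset_adjoin ⟨i, rfl⟩⟩ : B)
  let C := Subalgebra.algebraicClosure B A
  have hx : ∀ i : X × Fin 2 × Fin 2, (g i.1).1 i.2.1 i.2.2 ∈ C := by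
    rintro ⟨x, i, j⟩
    have h0 := hmem (x, 0)
    have h1 : IsAlgebraic B ((g x).1 0 1) := hmem (x, 1)
    have h2 : IsAlgebraic B ((g x).1 1 0) := hmem (x, 2)
    have hd := (g x).2
    rw [Matrix.det_fin_two, sub_eq_iff_eq_add] at hd
    have h4 : IsAlgebraic B ((g x).1 0 0) ∧ IsAlgebraic B ((g x).1 1 1) := by
      simp only [entryTriple, Matrix.cons_val_zero] at h0
      split_ifs at h0 with h
      · rw [h]
        exact ⟨isAlgebraic_zero, h0⟩
      · refine ⟨h0, IsAlgebraic.of_mul (mem_nonZeroDivisors_of_ne_zero h) h0 ?_⟩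
        rw [hd]
        exact isAlgebraic_one.add (h1.mul h2)
    fin_cases i <;> fin_cases j
    exacts [h4.1, h1, h2, h4.2]
  refine ⟨fun y => ?_⟩
  obtain ⟨f, rfl⟩ := hg y
  change coordHom g f ∈ C.restrictScalars ℂ
  have hle : (coordHom g).range ≤ C.restrictScalars ℂ := by
    rw [coordHom, ← Algebra.adjoin_range_eq_range_aeval]
    refine Algebra.adjoin_le ?_
    rintro _ ⟨i, rfl⟩
    exact hx i
  exact hle ⟨f, rfl⟩

variable [Fintype X]

theorem trdeg_le_of_coordHom_surjective {g : X → Matrix.SpecialLinearGroup (Fin 2) A}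
    (hg : Function.Surjective (coordHom g)) : trdeg ℂ A ≤ (3 * Fintype.card X : ℕ) := by
  have := isAlgebraic_adjoin_entryTriple hg
  refine (Algebra.IsAlgebraic.trdeg_le_cardinalMk ℂ (Set.range (entryTriple g))).trans ?_
  rw [← Cardinal.lift_le]
  refine Cardinal.mk_range_le_lift.trans ?_
  simp [mul_comm]

/-- The `3 |X|` elements have `A` algebraic over them, so maximal transcendence degree leaves no
room for a relation. -/
theorem algebraicIndependent_entryTriple {g : X → Matrix.SpecialLinearGroup (Fin 2) A}
    (hg : Function.Surjective (coordHom g)) (h : ((3 * Fintype.card X : ℕ) : Cardinal) ≤ trdeg ℂ A) :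
    AlgebraicIndependent ℂ (entryTriple g) := by
  have := isAlgebraic_adjoin_entryTriple hg
  have : FaithfulSMul ℂ A := (faithfulSMul_iff_algebraMap_injective _ _).mpr
    (algebraMap ℂ A).injective
  refine (Algebra.IsAlgebraic.isTranscendenceBasis_of_lift_le_trdeg_of_finite ℂ
    (entryTriple g) ?_).1
  rw [← Cardinal.lift_le] at h
  simpa [mul_comm] using h

/-- Evaluation of polynomials in the entries other than the lower right one. -/
def tripleHom {D : Type*} [CommRing D] [Algebra ℂ D]
    (g : X → Matrix.SpecialLinearGroup (Fin 2) D) : MvPolynomial (X × Fin 3) ℂ →ₐ[ℂ] D :=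
  aeval fun i => ![(g i.1).1 0 0, (g i.1).1 0 1, (g i.1).1 1 0] i.2

open scoped Classical in
theorem tripleHom_prod_erase_mul {D : Type*} [CommRing D] [Algebra ℂ D]
    (g : X → Matrix.SpecialLinearGroup (Fin 2) D) (x : X) :
    tripleHom g ((∏ y ∈ Finset.univ.erase x, MvPolynomial.X (y, 0)) *
      (1 + MvPolynomial.X (x, 1) * MvPolynomial.X (x, 2))) =
    (∏ x, (g x).1 0 0) * (g x).1 1 1 := by
  have hd := (g x).2
  rw [Matrix.det_fin_two, sub_eq_iff_eq_add] at hd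
  rw [← Finset.mul_prod_erase _ _ (Finset.mem_univ x)]
  simp [tripleHom, map_prod]
  linear_combination (-∏ y ∈ Finset.univ.erase x, (g y).1 0 0) * hd

/-- The lower right entry is `(1 + g₀₁ g₁₀) / g₀₀`. Having the same `m` and `q` at `g` and at `g₀`
is what carries vanishing from one to the other. -/
theorem exists_clear_denominators {A D : Type*} [CommRing A] [Algebra ℂ A] [CommRing D]
    [Algebra ℂ D] (g : X → Matrix.SpecialLinearGroup (Fin 2) A)
    (g₀ : X → Matrix.SpecialLinearGroup (Fin 2) D)
    (f : CoordRing X) : ∃ (m : ℕ) (q : MvPolynomial (X × Fin 3) ℂ),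
      tripleHom g q = (∏ x, (g x).1 0 0) ^ m * coordHom g f ∧
      tripleHom g₀ q = (∏ x, (g₀ x).1 0 0) ^ m * coordHom g₀ f := by
  classical
  let u : MvPolynomial (X × Fin 3) ℂ := ∏ x, MvPolynomial.X (x, 0)
  have hu : tripleHom g u = ∏ x, (g x).1 0 0 := by simp [u, tripleHom, map_prod]
  have hu₀ : tripleHom g₀ u = ∏ x, (g₀ x).1 0 0 := by simp [u, tripleHom, map_prod]
  rw [← hu, ← hu₀]
  induction f using MvPolynomial.induction_on with
  | C c => exact ⟨0, MvPolynomial.C c, by simp [tripleHom, coordHom], by simp [tripleHom, coordHom]⟩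
  | add f₁ f₂ ih₁ ih₂ =>
    obtain ⟨m₁, q₁, h₁, k₁⟩ := ih₁
    obtain ⟨m₂, q₂, h₂, k₂⟩ := ih₂
    refine ⟨m₁ + m₂, u ^ m₂ * q₁ + u ^ m₁ * q₂, ?_, ?_⟩
    · simp only [map_add, map_mul, map_pow, h₁, h₂]
      ring
    · simp only [map_add, map_mul, map_pow, k₁, k₂]
      ring
  | mul_X f i ih =>
    obtain ⟨m, q, h, k⟩ := ih
    have key : ∃ (l : ℕ) (r : MvPolynomial (X × Fin 3) ℂ),
        tripleHom g r = tripleHom g u ^ l * (g i.1).1 i.2.1 i.2.2 ∧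
        tripleHom g₀ r = tripleHom g₀ u ^ l * (g₀ i.1).1 i.2.1 i.2.2 := by
      rcases i with ⟨x, i, j⟩
      fin_cases i <;> fin_cases j
      · exact ⟨0, MvPolynomial.X (x, 0), by simp [tripleHom], by simp [tripleHom]⟩
      · exact ⟨0, MvPolynomial.X (x, 1), by simp [tripleHom], by simp [tripleHom]⟩
      · exact ⟨0, MvPolynomial.X (x, 2), by simp [tripleHom], by simp [tripleHom]⟩
      · refine ⟨1, _, (tripleHom_prod_erase_mul g x).trans ?_,
          (tripleHom_prod_erase_mul g₀ x).trans ?_⟩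
        · rw [hu, pow_one]
          rfl
        · rw [hu₀, pow_one]
          rfl
    obtain ⟨l, r, hr, kr⟩ := key
    refine ⟨m + l, q * r, ?_, ?_⟩
    · rw [map_mul, map_mul, h, hr, coordHom_X]
      ring
    · rw [map_mul, map_mul, k, kr, coordHom_X]
      ring

/-- A family of matrices of maximal transcendence degree specializes to all families of matrices
with non-vanishing upper left entries. -/
theorem ker_coordHom_le_of_le_trdeg {g : X → Matrix.SpecialLinearGroup (Fin 2) A}
    (hg : Function.Surjective (coordHom g)) (h : ((3 * Fintype.card X : ℕ) : Cardinal) ≤ trdeg ℂ A)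
    {g₀ : X → Matrix.SpecialLinearGroup (Fin 2) ℂ} (hg₀ : ∀ x, (g₀ x).1 0 0 ≠ 0) :
    RingHom.ker (coordHom g) ≤ RingHom.ker (coordHom g₀) := by
  classical
  have hind := algebraicIndependent_entryTriple hg h
  -- Otherwise the determinant would give the relation `g₀₁ g₁₀ = -1` between independent entries.
  -- So `entryTriple` uses the upper left entries and agrees with `tripleHom`.
  have hne : ∀ x, (g x).1 0 0 ≠ 0 := by
    intro x hx
    have hd := (g x).2
    rw [Matrix.det_fin_two, hx] at hd
    have h0 : aeval (entryTriple g)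
        (MvPolynomial.X (x, 1) * MvPolynomial.X (x, 2) + 1 : MvPolynomial (X × Fin 3) ℂ) = 0 := by
      simp [entryTriple]
      linear_combination -hd
    have h1 := hind.eq_zero_of_aeval_eq_zero _ h0
    have h2 := congrArg (MvPolynomial.eval 0) h1
    simp at h2
  have heq : tripleHom g = aeval (entryTriple g) := by
    ext ⟨x, i⟩
    fin_cases i <;> simp [tripleHom, entryTriple, hne]
  intro f hf
  obtain ⟨m, q, h₁, h₂⟩ := exists_clear_denominators g g₀ f
  rw [RingHom.mem_ker] at hf ⊢
  rw [hf, mul_zero, heq] at h₁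
  rw [hind.eq_zero_of_aeval_eq_zero _ h₁, map_zero, eq_comm, mul_eq_zero] at h₂
  exact h₂.resolve_left (pow_ne_zero _ (Finset.prod_ne_zero_iff.mpr fun x _ => hg₀ x))

end Triples

/-! ### Adjoining a root of a word -/

section Roots

variable {X : Type*}

theorem coordHom_range {D : Type*} [CommRing D] [Algebra ℂ D]
    (g : X → Matrix.SpecialLinearGroup (Fin 2) D) :
    (coordHom g).range =
      Algebra.adjoin ℂ (Set.range fun i : X × Fin 2 × Fin 2 => (g i.1).1 i.2.1 i.2.2) := by
  rw [coordHom, ← Algebra.adjoin_range_eq_range_aeval]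

theorem entry_mem_range {D : Type*} [CommRing D] [Algebra ℂ D]
    (g : X → Matrix.SpecialLinearGroup (Fin 2) D) (x : X) (i j : Fin 2) :
    (g x).1 i j ∈ (coordHom g).range :=
  ⟨MvPolynomial.X (x, i, j), coordHom_X g _⟩

theorem lift_entry_mem_range {D : Type*} [CommRing D] [Algebra ℂ D]
    (g : X → Matrix.SpecialLinearGroup (Fin 2) D) (w : FreeGroup X) (i j : Fin 2) :
    (FreeGroup.lift g w).1 i j ∈ (coordHom g).range :=
  ⟨wordMatrix w i j, coordHom_wordMatrix g w i j⟩

theorem exists_coordHom_surjective {L : Type*} [CommRing L] [IsDomain L] [Algebra ℂ L]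
    (g : X → Matrix.SpecialLinearGroup (Fin 2) L) :
    ∃ g' : X → Matrix.SpecialLinearGroup (Fin 2) (coordHom g).range,
      coordHom g' = (coordHom g).rangeRestrict := by
  -- For the trivial word only the determinant equations remain.
  refine exists_coordHom_eq 1 _ ?_
  have h := (repIdeal_le_ker_iff 1 g).mpr (by simp)
  intro f hf
  exact Subtype.ext (h hf)

variable {L : Type*} [Field L] [Algebra ℂ L]

theorem trdeg_range_option_le (g : Option X → Matrix.SpecialLinearGroup (Fin 2) L) {ι : Type*}
    [Fintype ι] (x : ι → L)
    (hx : ∀ i j, IsAlgebraic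
      (Algebra.adjoin (coordHom fun x => g (some x)).range (Set.range x)) ((g none).1 i j)) :
    trdeg ℂ (coordHom g).range ≤
      trdeg ℂ (coordHom fun x => g (some x)).range + Fintype.card ι := by
  rw [coordHom_range g]
  refine trdeg_adjoin_le_add _ x _ ?_
  rintro _ ⟨⟨_ | y, i, j⟩, rfl⟩
  · exact hx i j
  · have := isAlgebraic_algebraMap (A := L) (algebraMap (coordHom fun x => g (some x)).range
      (Algebra.adjoin (coordHom fun x => g (some x)).range (Set.range x))
        ⟨_, entry_mem_range (fun x => g (some x)) y i j⟩)
    exact this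

variable [IsAlgClosed L]

/-- Write `h ^ p = α h + β` with `α`, `β` polynomial in the trace of `h`, which is algebraic. As `h
^ p` is not `±1`, `α ≠ 0`, and `h` can be solved for. -/
theorem isAlgebraic_entry_of_pow_eq {S₀ : Subalgebra ℂ L}
    (h M : Matrix.SpecialLinearGroup (Fin 2) L) {p : ℕ} (hp : p ≠ 0)
    (hM : ∀ i j, M.1 i j ∈ S₀) (hne : ¬ (M = 1 ∨ M = -1)) (hpow : M = h ^ p ∨ M = -h ^ p)
    (i j : Fin 2) : IsAlgebraic S₀ (h.1 i j) := by
  have : CharZero L := charZero_of_injective_algebraMap (algebraMap ℂ L).injective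
  have hM' : ∀ i j, IsAlgebraic S₀ ((h.1 ^ p) i j) := by
    intro i j
    have h1 : IsAlgebraic S₀ (M.1 i j) := isAlgebraic_algebraMap (⟨_, hM i j⟩ : S₀)
    rcases hpow with h2 | h2
    · rw [h2, Matrix.SpecialLinearGroup.coe_pow] at h1
      exact h1
    · rw [h2] at h1
      have h3 := h1.neg
      simpa using h3
  have ht : IsAlgebraic S₀ h.1.trace := by
    refine h.isAlgebraic_trace hp ?_
    rw [Matrix.trace_fin_two]
    exact (hM' 0 0).add (hM' 1 1)
  obtain ⟨α, hα, β, hβ, heq⟩ := h.exists_pow_eq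
    (Subalgebra.algebraicClosure S₀ L).toSubring ht p
  have hα0 : α ≠ 0 := by
    rintro rfl
    have hs : h ^ p = 1 ∨ h ^ p = -1 := by
      rw [eq_one_or_neg_one_iff, Matrix.SpecialLinearGroup.coe_pow, heq]
      simp
    rcases hpow with rfl | rfl
    · exact hne hs
    · refine hne (hs.symm.imp (fun e => ?_) fun e => ?_) <;> simp [e]
  have hij : h.1 i j = α⁻¹ * ((h.1 ^ p) i j - β * (1 : Matrix (Fin 2) (Fin 2) L) i j) := by
    rw [heq]
    simp only [Matrix.add_apply, Matrix.smul_apply, smul_eq_mul]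
    field_simp
    ring
  rw [hij]
  refine (IsAlgebraic.inv hα).mul ((hM' i j).sub (IsAlgebraic.mul hβ ?_))
  rw [Matrix.one_apply]
  split_ifs
  exacts [isAlgebraic_one, isAlgebraic_zero]

/-- A matrix of finite order contributes at most two to the transcendence degree. -/
theorem exists_isAlgebraic_entry_of_pow_eq_one (S₀ : Subalgebra ℂ L)
    (h : Matrix.SpecialLinearGroup (Fin 2) L) {p : ℕ} (hp : p ≠ 0)
    (hpow : h ^ p = 1 ∨ h ^ p = -1) : ∃ x : Fin 2 → L, ∀ i j,
      IsAlgebraic (Algebra.adjoin S₀ (Set.range x)) (h.1 i j) := by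
  have : CharZero L := charZero_of_injective_algebraMap (algebraMap ℂ L).injective
  classical
  -- The algebraic trace determines the other diagonal entry, and the determinant then gives the
  -- product of the off-diagonal entries.
  let x : Fin 2 → L := ![h.1 0 0, if h.1 0 1 = 0 then h.1 1 0 else h.1 0 1]
  refine ⟨x, ?_⟩
  set B := Algebra.adjoin S₀ (Set.range x)
  have hmem : ∀ i, IsAlgebraic B (x i) := fun i =>
    isAlgebraic_algebraMap (⟨_, Algebra.subset_adjoin ⟨i, rfl⟩⟩ : B)
  have ht : IsAlgebraic B h.1.trace := by
    refine h.isAlgebraic_trace hp ?_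
    rw [← Matrix.SpecialLinearGroup.coe_pow]
    rcases hpow with e | e
    · rw [e]
      simpa using isAlgebraic_natCast 2
    · rw [e]
      simpa using (isAlgebraic_natCast (R := B) (A := L) 2).neg
  have h00 : IsAlgebraic B (h.1 0 0) := hmem 0
  have h11 : IsAlgebraic B (h.1 1 1) := by
    have := ht.sub h00
    rwa [Matrix.trace_fin_two, add_sub_cancel_left] at this
  have hd := h.2
  rw [Matrix.det_fin_two] at hd
  have h1 := hmem 1
  have hoff : IsAlgebraic B (h.1 0 1) ∧ IsAlgebraic B (h.1 1 0) := by
    simp only [x, Matrix.cons_val_one, Matrix.cons_val_zero] at h1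
    split_ifs at h1 with hz
    · rw [hz]
      exact ⟨isAlgebraic_zero, h1⟩
    · refine ⟨h1, IsAlgebraic.of_mul (mem_nonZeroDivisors_of_ne_zero hz) h1 ?_⟩
      rw [show h.1 0 1 * h.1 1 0 = h.1 0 0 * h.1 1 1 - 1 by linear_combination -hd]
      exact (h00.mul h11).sub isAlgebraic_one
  intro i j
  fin_cases i <;> fin_cases j
  exacts [h00, hoff.1, hoff.2, h11]

end Roots

/-! ### Generic elements of finite order -/

section FiniteOrder

/-- A primitive `2p`-th root of unity; `p > 1` ensures `ζ ^ 2 ≠ 1`. -/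
theorem exists_inv_ne_pow_eq_neg_one {p : ℕ} (hp : 1 < p) :
    ∃ ζ : ℂ, ζ ≠ 0 ∧ ζ ≠ ζ⁻¹ ∧ ζ ^ p = -1 := by
  have hprim := Complex.isPrimitiveRoot_exp (2 * p) (by omega)
  set ζ := Complex.exp (2 * Real.pi * Complex.I / (2 * p : ℕ))
  have h0 : ζ ≠ 0 := Complex.exp_ne_zero _
  refine ⟨ζ, h0, fun h => ?_, ?_⟩
  · refine hprim.pow_ne_one_of_pos_of_lt (l := 2) (by norm_num) (by omega) ?_
    rw [pow_two]
    nth_rewrite 2 [h]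
    exact mul_inv_cancel₀ h0
  · have h1 : (ζ ^ p) * (ζ ^ p) = 1 := by
      rw [← pow_add, ← two_mul]
      exact hprim.pow_eq_one
    exact (mul_self_eq_one_iff.mp h1).resolve_left
      (hprim.pow_ne_one_of_pos_of_lt (by omega) (by omega))

/-- The characteristic polynomial `(T - ζ)(T - ζ⁻¹)` has distinct roots, so it divides `T ^ p + 1`.
-/
theorem pow_eq_neg_one_of_trace_eq {D : Type*} [CommRing D] [Algebra ℂ D] {p : ℕ} {ζ : ℂ}
    (h0 : ζ ≠ 0) (hne : ζ ≠ ζ⁻¹) (hζ : ζ ^ p = -1) (h : Matrix.SpecialLinearGroup (Fin 2) D)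
    (ht : h.1.trace = algebraMap ℂ D (ζ + ζ⁻¹)) : h ^ p = -1 := by
  have hdvd : (Polynomial.X - Polynomial.C ζ) * (Polynomial.X - Polynomial.C ζ⁻¹) ∣
      (Polynomial.X ^ p + 1 : Polynomial ℂ) := by
    refine IsCoprime.mul_dvd (Polynomial.isCoprime_X_sub_C_of_isUnit_sub
      (sub_ne_zero.mpr hne).isUnit) ?_ ?_ <;> rw [Polynomial.dvd_iff_isRoot]
    · simp [hζ]
    · simp [hζ]
  obtain ⟨q, hq⟩ := hdvd
  have hzero : Polynomial.aeval h.1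
      ((Polynomial.X - Polynomial.C ζ) * (Polynomial.X - Polynomial.C ζ⁻¹)) = 0 := by
    have h1 := h.sq_fin_two
    rw [ht, algebraMap_smul] at h1
    simp only [map_mul, map_sub, Polynomial.aeval_X, Polynomial.aeval_C,
      Algebra.algebraMap_eq_smul_one]
    rw [sub_mul, mul_sub, mul_sub, h1, smul_mul_smul_comm, mul_inv_cancel₀ h0, smul_mul_assoc,
      mul_smul_comm, one_mul, mul_one, mul_one]
    module
  have h2 := congrArg (Polynomial.aeval h.1) hq
  rw [map_mul, hzero, zero_mul, map_add, map_pow, Polynomial.aeval_X, map_one] at h2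
  refine Subtype.ext ?_
  rw [Matrix.SpecialLinearGroup.coe_pow, eq_neg_of_add_eq_zero_left h2]
  simp

universe u

/-- A generic element of order `2 p`, algebraically independent of a given field. -/
theorem exists_generic_pow_eq_neg_one (L : Type u) [Field L] [Algebra ℂ L] {p : ℕ} (hp : 1 < p) :
    ∃ (L' : Type u) (_ : Field L') (_ : Algebra ℂ L') (φ : L →ₐ[ℂ] L')
      (h : Matrix.SpecialLinearGroup (Fin 2) L'), h ^ p = -1 ∧
      ∀ {ι : Type} (x : ι → L), AlgebraicIndependent ℂ x →
        AlgebraicIndependent ℂ (Sum.elim (fun i => h.1 0 i) (fun i => φ (x i)) : Fin 2 ⊕ ι → L') := by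
  obtain ⟨ζ, h0, hne, hζ⟩ := exists_inv_ne_pow_eq_neg_one hp
  let R := MvPolynomial (Fin 2) L
  let L' := FractionRing R
  let a : L' := algebraMap R L' (X 0)
  let b : L' := algebraMap R L' (X 1)
  have hb : b ≠ 0 :=
    (map_ne_zero_iff _ (IsFractionRing.injective R L')).mpr (MvPolynomial.X_ne_zero 1)
  let t : L' := algebraMap ℂ L' (ζ + ζ⁻¹)
  -- The first row is free; the trace `t` and the determinant fix the second.
  let h : Matrix.SpecialLinearGroup (Fin 2) L' := ⟨!![a, b; (a * (t - a) - 1) / b, t - a], by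
    rw [Matrix.det_fin_two_of, mul_div_cancel₀ _ hb, sub_sub_cancel]⟩
  refine ⟨L', inferInstance, inferInstance,
    (Algebra.algHom ℂ L L'), h,
    pow_eq_neg_one_of_trace_eq h0 hne hζ h (by simp [h, t, Matrix.trace_fin_two]), ?_⟩
  intro ι x hx
  have hX : AlgebraicIndependent L (fun i : Fin 2 => h.1 0 i) := by
    have := (MvPolynomial.algebraicIndependent_X (Fin 2) L).map'
      (f := Algebra.algHom L R L') (IsFractionRing.injective R L')
    convert this using 1
    ext i
    fin_cases i <;> rfl
  exact hx.sumElim_comp hX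

end FiniteOrder

/-! ### Words in free groups are not identities of `PSL(2, ℂ)` -/

section FreeGroupWords

variable {X : Type*}

/-- The projection onto the line spanned by `(1, z (x, b))` along the line spanned by
`(1, z (x, !b))`. -/
def lineProj (z : X × Bool → ℂ) (a : X × Bool) : Matrix (Fin 2) (Fin 2) ℂ :=
  (z a - z (a.1, !a.2))⁻¹ • Matrix.vecMulVec ![1, z a] ![-z (a.1, !a.2), 1]

/-- In a reduced word no letter is followed by its inverse, so the image line of each rank-one
projection is not the kernel of the projection to its left. -/
theorem prod_lineProj_ne_zero {z : X × Bool → ℂ} (hz : Function.Injective z) :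
    ∀ l : List (X × Bool), FreeGroup.IsReduced l → (l.map (lineProj z)).prod ≠ 0 := by
  have key : ∀ (l : List (X × Bool)) (a : X × Bool), FreeGroup.IsReduced (a :: l) →
      ∃ r : Fin 2 → ℂ, r ≠ 0 ∧
        ((a :: l).map (lineProj z)).prod = Matrix.vecMulVec ![1, z a] r := by
    intro l
    induction l with
    | nil =>
      intro a _
      refine ⟨(z a - z (a.1, !a.2))⁻¹ • ![-z (a.1, !a.2), 1], ?_, ?_⟩
      · refine smul_ne_zero (inv_ne_zero (sub_ne_zero.mpr fun h => ?_)) fun h => ?_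
        · have := congrArg Prod.snd (hz h)
          simp at this
        · have := congrFun h 1
          simp at this
      · rw [List.map_singleton, List.prod_singleton, lineProj, Matrix.vecMulVec_smul]
    | cons c l ih =>
      intro a hred
      have hred' := hred
      rw [FreeGroup.isReduced_cons_cons] at hred'
      obtain ⟨r, hr, hprod⟩ := ih c hred'.2
      have hne : z a - z (a.1, !a.2) ≠ 0 := sub_ne_zero.mpr fun h => by
        have := congrArg Prod.snd (hz h)
        simp at this
      have hne' : z c - z (a.1, !a.2) ≠ 0 := sub_ne_zero.mpr fun h => by
        have h1 := hz h
        have h2 := hred'.1 (congrArg Prod.fst h1).symm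
        have h3 := congrArg Prod.snd h1
        simp [h2] at h3
      refine ⟨((z a - z (a.1, !a.2))⁻¹ * (z c - z (a.1, !a.2))) • r,
        smul_ne_zero (mul_ne_zero (inv_ne_zero hne) hne') hr, ?_⟩
      rw [List.map_cons, List.prod_cons, hprod, lineProj, smul_mul_assoc,
        Matrix.vecMulVec_mul_vecMulVec]
      rw [Matrix.vecMulVec_smul, Matrix.vecMulVec_smul, smul_smul, Matrix.vec2_dotProduct]
      congr 2
      simp
      ring
  rintro (_ | ⟨a, l⟩) hl
  · simp
  · obtain ⟨r, hr, h⟩ := key l a hl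
    rw [h]
    intro h0
    refine hr (funext fun j => ?_)
    have := congrFun (congrFun h0 0) j
    simpa [Matrix.vecMulVec_apply] using this

theorem det_lineProj_add {z : X × Bool → ℂ} (hz : Function.Injective z) (x : X) (s t : ℂ) :
    (s • lineProj z (x, true) + t • lineProj z (x, false)).det = s * t := by
  have hne : z (x, true) - z (x, false) ≠ 0 := sub_ne_zero.mpr (hz.ne (by simp))
  have hne' : z (x, false) - z (x, true) ≠ 0 := sub_ne_zero.mpr (hz.ne (by simp))
  simp [Matrix.det_fin_two, lineProj]
  grind

theorem adjugate_lineProj_add {z : X × Bool → ℂ} (hz : Function.Injective z) (x : X) (s t : ℂ) :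
    (s • lineProj z (x, true) + t • lineProj z (x, false)).adjugate =
      t • lineProj z (x, true) + s • lineProj z (x, false) := by
  have hne : z (x, true) - z (x, false) ≠ 0 := sub_ne_zero.mpr (hz.ne (by simp))
  have hne' : z (x, false) - z (x, true) ≠ 0 := sub_ne_zero.mpr (hz.ne (by simp))
  rw [Matrix.adjugate_fin_two]
  ext i j
  fin_cases i <;> fin_cases j <;> simp [lineProj] <;> grind

/-- The matrices with eigenvalues `s⁻¹` and `s` on two of the lines. -/
def lineMatrix {z : X × Bool → ℂ} (hz : Function.Injective z) {s : ℂ} (hs : s ≠ 0) (x : X) :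
    Matrix.SpecialLinearGroup (Fin 2) ℂ :=
  ⟨s⁻¹ • lineProj z (x, true) + s • lineProj z (x, false), by
    rw [det_lineProj_add hz, inv_mul_cancel₀ hs]⟩

theorem coe_lineMatrix {z : X × Bool → ℂ} (hz : Function.Injective z) {s : ℂ} (hs : s ≠ 0)
    (x : X) : (lineMatrix hz hs x).1 =
      s⁻¹ • lineProj z (x, true) + s • lineProj z (x, false) :=
  rfl

/-- One factor `s` per letter cancels the pole at `s = 0`; there the right-hand side becomes the
product of the projections. -/
theorem smul_lift_lineMatrix {z : X × Bool → ℂ} (hz : Function.Injective z) {s : ℂ} (hs : s ≠ 0)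
    (l : List (X × Bool)) :
    s ^ l.length • (FreeGroup.lift (lineMatrix hz hs) (FreeGroup.mk l)).1 =
      (l.map fun a => lineProj z a + s ^ 2 • lineProj z (a.1, !a.2)).prod := by
  rw [FreeGroup.lift_mk]
  induction l with
  | nil => simp
  | cons a l ih =>
    rw [List.map_cons, List.prod_cons, List.map_cons, List.prod_cons, ← ih,
      Matrix.SpecialLinearGroup.coe_mul, List.length_cons, pow_succ', ← smul_mul_smul_comm]
    congr 1
    rcases a with ⟨x, _ | _⟩
    · change s • ((lineMatrix hz hs x)⁻¹).1 = _ + s ^ 2 • lineProj z (x, true)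
      rw [Matrix.SpecialLinearGroup.coe_inv, coe_lineMatrix, adjugate_lineProj_add hz,
        smul_add, smul_smul, smul_smul, mul_inv_cancel₀ hs, one_smul,
        pow_two, add_comm]
    · change s • (lineMatrix hz hs x).1 = _ + s ^ 2 • lineProj z (x, false)
      rw [coe_lineMatrix, smul_add, smul_smul, smul_smul, mul_inv_cancel₀ hs, one_smul, pow_two]

/-- Non-trivial words take values other than `±1` on `SL(2, ℂ)`. -/
theorem exists_lift_ne_one [Finite X] {W : FreeGroup X} (hW : W ≠ 1) :
    ∃ g : X → Matrix.SpecialLinearGroup (Fin 2) ℂ, (∀ x, (g x).1 0 0 ≠ 0) ∧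
      ¬ (FreeGroup.lift g W = 1 ∨ FreeGroup.lift g W = -1) := by
  classical
  obtain ⟨n, ⟨e⟩⟩ := Finite.exists_equiv_fin (X × Bool)
  -- The shift by one makes `z` nowhere zero, so the upper left entries of the matrices do not
  -- vanish for small `s ≠ 0`.
  let z : X × Bool → ℂ := fun a => ((e a : ℕ) + 1 : ℕ)
  have hz : Function.Injective z := fun a b h => e.injective (Fin.ext (by
    have := Nat.cast_injective (R := ℂ) h
    omega))
  have hz0 : ∀ a, z a ≠ 0 := fun a => Nat.cast_ne_zero.mpr (by omega)
  let F : ℂ → Matrix (Fin 2) (Fin 2) ℂ := fun s =>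
    (W.toWord.map fun a => lineProj z a + s ^ 2 • lineProj z (a.1, !a.2)).prod
  have hcont : Continuous F := by
    refine continuous_list_prod _ fun a _ => ?_
    fun_prop
  have hF0 : F 0 ≠ 0 := by
    have := prod_lineProj_ne_zero hz W.toWord FreeGroup.isReduced_toWord
    simpa [F] using this
  obtain ⟨i, j, hij⟩ : ∃ i j, F 0 i j ≠ 0 := by
    by_contra! h
    exact hF0 (Matrix.ext h)
  have hlen : W.toWord.length ≠ 0 := by
    simpa using hW
  have hev1 : ∀ᶠ s in nhdsWithin (0 : ℂ) {0}ᶜ, ∀ x,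
      -z (x, false) + s ^ 2 * z (x, true) ≠ 0 := by
    rw [Filter.eventually_all]
    intro x
    have hc : Continuous fun s : ℂ => -z (x, false) + s ^ 2 * z (x, true) := by fun_prop
    exact (hc.continuousAt.eventually_ne (by simp [hz0])).filter_mono nhdsWithin_le_nhds
  -- If `W = ±1` at the matrices with parameter `s`, this difference is zero; squaring removes the
  -- sign. At `s = 0` it is `F 0 i j ^ 2 ≠ 0`, because `W` has positive length.
  have hev2 : ∀ᶠ s in nhdsWithin (0 : ℂ) {0}ᶜ,
      F s i j ^ 2 - (s ^ W.toWord.length) ^ 2 * (1 : Matrix (Fin 2) (Fin 2) ℂ) i j ≠ 0 := by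
    have hc : Continuous fun s : ℂ =>
        F s i j ^ 2 - (s ^ W.toWord.length) ^ 2 * (1 : Matrix (Fin 2) (Fin 2) ℂ) i j := by
      have := hcont.matrix_elem i j
      fun_prop
    refine (hc.continuousAt.eventually_ne ?_).filter_mono nhdsWithin_le_nhds
    simp [hlen, hij]
  obtain ⟨s, ⟨h1, h2⟩, hs⟩ := ((hev1.and hev2).and self_mem_nhdsWithin).exists
  refine ⟨lineMatrix hz hs, fun x => ?_, fun hW1 => h2 ?_⟩
  · have hne : z (x, true) - z (x, false) ≠ 0 := sub_ne_zero.mpr (hz.ne (by simp))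
    have hne' : z (x, false) - z (x, true) ≠ 0 := sub_ne_zero.mpr (hz.ne (by simp))
    have hs' : s ≠ 0 := hs
    have := h1 x
    intro h0
    apply this
    simp [lineMatrix, lineProj] at h0
    grind
  · have h3 := smul_lift_lineMatrix hz hs W.toWord
    rw [FreeGroup.mk_toWord] at h3
    change _ = F s at h3
    rw [← h3]
    rcases hW1 with e | e <;> rw [e] <;> fin_cases i <;> fin_cases j <;> simp

end FreeGroupWords

/-! ### The dimension of the pinched representation variety -/

theorem IsAlgebraic.adjoin_base {R L : Type*} [CommRing R] [Field L] [Algebra R L]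
    [FaithfulSMul R L] {y : L} (h : IsAlgebraic R y) (s : Set L) :
    IsAlgebraic (Algebra.adjoin R s) y :=
  h.extendScalars fun _ _ hab => FaithfulSMul.algebraMap_injective R L
    (congrArg (algebraMap (Algebra.adjoin R s) L) hab)

section Pinched

universe u

variable {X : Type u} {W : FreeGroup X} {p : ℕ}

theorem lift_map_some {G : Type*} [Group G] (g : Option X → G) (W : FreeGroup X) :
    FreeGroup.lift g (FreeGroup.map some W) = FreeGroup.lift (fun x => g (some x)) W := by
  have : (FreeGroup.lift g).comp (FreeGroup.map some) = FreeGroup.lift fun x => g (some x) := by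
    ext x
    simp
  exact DFunLike.congr_fun this W

theorem lift_pinched_iff {D : Type*} [CommRing D]
    (g : Option X → Matrix.SpecialLinearGroup (Fin 2) D) :
    (FreeGroup.lift g (FreeGroup.map some W * (FreeGroup.of none ^ p)⁻¹) = 1 ∨
      FreeGroup.lift g (FreeGroup.map some W * (FreeGroup.of none ^ p)⁻¹) = -1) ↔
    FreeGroup.lift (fun x => g (some x)) W = g none ^ p ∨
      FreeGroup.lift (fun x => g (some x)) W = -g none ^ p := by
  rw [map_mul, lift_map_some, map_inv, map_pow, FreeGroup.lift_apply_of, mul_inv_eq_one,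
    mul_inv_eq_iff_eq_mul,
    neg_one_mul]

variable [Fintype X]

/-- A family of transcendence degree `3n` with `W = ±1` would specialize to one at which `W ≠ ±1`.
-/
theorem not_natCast_le_topologicalKrullDim (hW : W ≠ 1) :
    ¬ ((3 * Fintype.card X : ℕ) : WithBot ℕ∞) ≤ topologicalKrullDim (RepVariety {W}) := by
  intro h
  obtain ⟨L, _, _, _, g, x, hg, hx, hmem⟩ := exists_generic_of_natCast_le_topologicalKrullDim h
  obtain ⟨g₀, hg₀, hne⟩ := exists_lift_ne_one hW
  obtain ⟨g', hg'⟩ := exists_coordHom_surjective g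
  have hsurj : Function.Surjective (coordHom g') := by
    rw [hg']
    exact (coordHom g).rangeRestrict_surjective
  have hind : AlgebraicIndependent ℂ (fun i => (⟨x i, hmem i⟩ : (coordHom g).range)) :=
    AlgebraicIndependent.of_comp (coordHom g).range.val hx
  have hle := ker_coordHom_le_of_le_trdeg hsurj (by simpa using hind.lift_cardinalMk_le_trdeg) hg₀
  refine hne ((repIdeal_le_ker_iff W g₀).mp ?_)
  refine ((repIdeal_le_ker_iff W g).mpr hg).trans (le_trans (fun f hf => ?_) hle)
  rw [RingHom.mem_ker, hg']
  exact Subtype.ext hf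

/-- The generic family on `X` has `3n` independent entries, and up to sign the value of `W` there
has a `p`-th root over an algebraic closure. -/
theorem natCast_le_topologicalKrullDim_pinched (hp : 1 < p) :
    ((3 * Fintype.card X : ℕ) : WithBot ℕ∞) ≤
      topologicalKrullDim (RepVariety (pinchedRelators W p)) := by
  let R := MvPolynomial (X × Fin 3) ℂ
  let K := FractionRing R
  let L := AlgebraicClosure K
  let φ : R →ₐ[ℂ] L := (Algebra.ofId K L).restrictScalars ℂ |>.comp (Algebra.algHom ℂ R K)
  have hφ : Function.Injective φ :=
    (algebraMap K L).injective.comp (IsFractionRing.injective R K)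
  have : CharZero L := charZero_of_injective_algebraMap (algebraMap ℂ L).injective
  let a : X × Fin 3 → L := fun i => φ (MvPolynomial.X i)
  have ha : ∀ i, a i ≠ 0 := fun i => (map_ne_zero_iff _ hφ).mpr (MvPolynomial.X_ne_zero i)
  let g : X → Matrix.SpecialLinearGroup (Fin 2) L := fun x =>
    ⟨!![a (x, 0), a (x, 1); a (x, 2), (1 + a (x, 1) * a (x, 2)) / a (x, 0)], by
      rw [Matrix.det_fin_two_of, mul_div_cancel₀ _ (ha _), add_sub_cancel_right]⟩
  obtain ⟨h, hh⟩ := (FreeGroup.lift g W).exists_pow_eq_or_eq_neg (p := p) (by omega)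
  have hind : AlgebraicIndependent ℂ a :=
    (MvPolynomial.algebraicIndependent_X (X × Fin 3) ℂ).map' hφ
  let g' : Option X → Matrix.SpecialLinearGroup (Fin 2) L := fun o => o.elim h g
  have hg' : FreeGroup.lift g W = h ^ p ∨ FreeGroup.lift g W = -h ^ p :=
    hh.imp Eq.symm fun e => by rw [e, neg_neg]
  have key := natCast_le_topologicalKrullDim_of_generic (g := g') ((lift_pinched_iff g').mpr hg')
    hind (by
      rintro ⟨x, i⟩
      fin_cases i
      · exact entry_mem_range g' (some x) 0 0
      · exact entry_mem_range g' (some x) 0 1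
      · exact entry_mem_range g' (some x) 1 0)
  rw [Fintype.card_prod, Fintype.card_fin, mul_comm] at key
  exact key

theorem le_or_exists_le_of_natCast_le_pinched (hp : 1 < p) {N : ℕ}
    (h : (N : WithBot ℕ∞) ≤ topologicalKrullDim (RepVariety (pinchedRelators W p))) :
    N ≤ 3 * Fintype.card X ∨
      ∃ k : ℕ, (k : WithBot ℕ∞) ≤ topologicalKrullDim (RepVariety {W}) ∧ N ≤ k + 2 := by
  obtain ⟨L, _, _, _, g, x, hg, hx, hmem⟩ := exists_generic_of_natCast_le_topologicalKrullDim h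
  rw [lift_pinched_iff] at hg
  have hN : (N : Cardinal) ≤ trdeg ℂ (coordHom g).range := by
    have hind : AlgebraicIndependent ℂ (fun i => (⟨x i, hmem i⟩ : (coordHom g).range)) :=
      AlgebraicIndependent.of_comp (coordHom g).range.val hx
    simpa using hind.lift_cardinalMk_le_trdeg
  let g₀ : X → Matrix.SpecialLinearGroup (Fin 2) L := fun x => g (some x)
  obtain ⟨g', hg'⟩ := exists_coordHom_surjective g₀
  have hle : trdeg ℂ (coordHom g₀).range ≤ (3 * Fintype.card X : ℕ) :=
    trdeg_le_of_coordHom_surjective (g := g') (by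
      rw [hg']
      exact (coordHom g₀).rangeRestrict_surjective)
  by_cases hone : FreeGroup.lift g₀ W = 1 ∨ FreeGroup.lift g₀ W = -1
  · right
    have hpow : g none ^ p = 1 ∨ g none ^ p = -1 := by
      rcases hg with e | e
      · rwa [← e]
      · rw [← neg_eq_iff_eq_neg] at e
        rw [← e]
        exact hone.symm.imp (fun e => by simp [g₀, e]) fun e => by simp [g₀, e]
    obtain ⟨y, hy⟩ := exists_isAlgebraic_entry_of_pow_eq_one (coordHom g₀).range (g none)
      (p := p) (by omega) hpow
    have h2 := hN.trans (trdeg_range_option_le g y hy)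
    obtain ⟨k, hk⟩ := Cardinal.lt_aleph0.mp (hle.trans_lt (Cardinal.natCast_lt_aleph0))
    obtain ⟨z, hz⟩ := exists_algebraicIndependent_of_le_trdeg hk.ge
    refine ⟨k, ?_, ?_⟩
    · have := natCast_le_topologicalKrullDim_of_generic hone
        (hz.map' (f := (coordHom g₀).range.val) Subtype.val_injective) fun i => (z i).2
      simpa using this
    · change _ ≤ trdeg ℂ (coordHom g₀).range + _ at h2
      rw [hk, Fintype.card_fin] at h2
      exact_mod_cast h2
  · left
    have halg := isAlgebraic_entry_of_pow_eq (S₀ := (coordHom g₀).range) (g none) _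
      (p := p) (by omega) (lift_entry_mem_range g₀ W) hone hg
    have h2 := hN.trans (trdeg_range_option_le g (ι := Empty) Empty.elim
      fun i j => (halg i j).adjoin_base _)
    rw [Fintype.card_empty, Nat.cast_zero, add_zero] at h2
    exact_mod_cast h2.trans hle

/-- When `W = ±1`, the relation only asks `y ^ p = ±1`, so `y` can be chosen independently of the
images of `X`, adding two parameters. -/
theorem exists_generic_pinched (hp : 1 < p) {k : ℕ}
    (h : (k : WithBot ℕ∞) ≤ topologicalKrullDim (RepVariety {W})) :
    ∃ (L : Type u) (_ : Field L) (_ : Algebra ℂ L)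
      (g : Option X → Matrix.SpecialLinearGroup (Fin 2) L) (x : Fin 2 ⊕ Fin k → L),
      (FreeGroup.lift (fun x => g (some x)) W = 1 ∨ FreeGroup.lift (fun x => g (some x)) W = -1) ∧
      g none ^ p = -1 ∧ AlgebraicIndependent ℂ x ∧ ∀ i, x i ∈ (coordHom g).range := by
  obtain ⟨L, _, _, _, g, x, hg, hx, hmem⟩ := exists_generic_of_natCast_le_topologicalKrullDim h
  obtain ⟨L', _, _, φ, t, ht, hind⟩ := exists_generic_pow_eq_neg_one L hp
  let g₀ : X → Matrix.SpecialLinearGroup (Fin 2) L' := fun x =>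
    Matrix.SpecialLinearGroup.map φ.toRingHom (g x)
  have hlift : FreeGroup.lift g₀ W =
      Matrix.SpecialLinearGroup.map φ.toRingHom (FreeGroup.lift g W) := by
    have : FreeGroup.lift g₀ =
        (Matrix.SpecialLinearGroup.map φ.toRingHom).comp (FreeGroup.lift g) := by
      ext1 x
      simp [g₀]
    rw [this]
    rfl
  refine ⟨L', inferInstance, inferInstance, fun o => o.elim t g₀, _, ?_, ht, hind x hx, ?_⟩
  · change FreeGroup.lift g₀ W = 1 ∨ FreeGroup.lift g₀ W = -1
    rw [hlift]
    refine hg.imp (fun e => by rw [e, map_one]) fun e => ?_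
    rw [e]
    ext i j
    fin_cases i <;> fin_cases j <;> simp
  · rintro (i | i)
    · exact entry_mem_range (fun o : Option X => o.elim t g₀) none 0 i
    · obtain ⟨f, hf⟩ := hmem i
      refine ⟨rename (fun j => (some j.1, j.2)) f, ?_⟩
      have hcomp : (coordHom fun o : Option X => o.elim t g₀).comp
          (rename fun j => (some j.1, j.2)) = φ.comp (coordHom g) := by
        ext ⟨y, a, b⟩
        simp [g₀]
      exact (DFunLike.congr_fun hcomp f).trans (congrArg φ hf)

theorem exists_gens_lift_ne_one (hp : 1 < p) (hW : W ≠ 1) :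
    ∃ g : Option X → Matrix.SpecialLinearGroup (Fin 2) ℂ,
      (FreeGroup.lift (fun x => g (some x)) W = g none ^ p ∨
        FreeGroup.lift (fun x => g (some x)) W = -g none ^ p) ∧
      ¬ (FreeGroup.lift (fun x => g (some x)) W = 1 ∨
        FreeGroup.lift (fun x => g (some x)) W = -1) := by
  obtain ⟨g, -, hg⟩ := exists_lift_ne_one hW
  obtain ⟨h, hh⟩ := (FreeGroup.lift g W).exists_pow_eq_or_eq_neg (p := p) (by omega)
  exact ⟨fun o => o.elim h g, hh.imp Eq.symm fun e => by simp [e], hg⟩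

/-- The representations killing `W` form a proper subset of the pinched representation variety. -/
theorem repLocus_ker_ne_univ (hp : 1 < p) (hW : W ≠ 1) {L : Type*} [CommRing L] [IsDomain L]
    [Algebra ℂ L] {g : Option X → Matrix.SpecialLinearGroup (Fin 2) L}
    (hg : FreeGroup.lift (fun x => g (some x)) W = 1 ∨
      FreeGroup.lift (fun x => g (some x)) W = -1) :
    repLocus (FreeGroup.map some W * (FreeGroup.of none ^ p)⁻¹) (RingHom.ker (coordHom g)) ≠
      Set.univ := by
  intro huniv
  obtain ⟨g₀, hg₀, hne⟩ := exists_gens_lift_ne_one hp hW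
  obtain ⟨ρ, hρ⟩ := exists_rep_of_repIdeal_le_ker
    ((repIdeal_le_ker_iff _ g₀).mpr ((lift_pinched_iff g₀).mpr hg₀))
  -- A lift of `ρ` would be a specialization of `g`, so it would satisfy `W = ±1` as well, whereas
  -- `ρ` does not kill `W`.
  obtain ⟨g₁, hle, hρ₁⟩ := huniv.symm ▸ Set.mem_univ ρ
  rw [← lift_map_some] at hg hne
  have h1 := ((repIdeal_le_ker_iff _ g).mpr hg).trans hle
  rw [repIdeal_le_ker_iff, ← toPSL2C_eq_one_iff, ← ρ.apply_eq hρ₁, ρ.apply_eq hρ,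
    toPSL2C_eq_one_iff] at h1
  exact hne h1

end Pinched

theorem WithBot.natCast_succ_le_of_not_le {d : WithBot ℕ∞} {m : ℕ} (h : ¬ d ≤ m) :
    ((m + 1 : ℕ) : WithBot ℕ∞) ≤ d := by
  induction d using WithBot.recBotCoe with
  | bot => simp at h
  | coe d =>
    have h1 : (m : ℕ∞) < d := by
      rw [not_le] at h
      exact_mod_cast h
    exact_mod_cast Order.add_one_le_of_lt h1

end

theorem theoremC {X : Type*} [Fintype X] (n : ℕ) (hn : Fintype.card X = n)
    (p : ℕ) (hp : 1 < p) (W : FreeGroup X) (hW : W ≠ 1) :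
    (topologicalKrullDim (RepVariety (pinchedRelators W p)) =
        max ((3 * n : ℕ) : WithBot ℕ∞) (topologicalKrullDim (RepVariety {W}) + 2) ∧
      max ((3 * n : ℕ) : WithBot ℕ∞) (topologicalKrullDim (RepVariety {W}) + 2) ≤
        ((3 * n + 1 : ℕ) : WithBot ℕ∞)) ∧
    (((3 * n : ℕ) : WithBot ℕ∞) ≤ topologicalKrullDim (RepVariety {W}) + 2 →
      ¬ PreirreducibleSpace (RepVariety (pinchedRelators W p))) := by
  subst hn
  have hlt := not_natCast_le_topologicalKrullDim hW
  -- The trivial representation excludes `⊥`, and the bound `hlt` excludes `⊤`.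
  obtain ⟨e, he⟩ : ∃ e : ℕ, topologicalKrullDim (RepVariety {W}) = e := by
    have h0 : (0 : WithBot ℕ∞) ≤ topologicalKrullDim (RepVariety {W}) := by
      have := natCast_le_topologicalKrullDim_of_generic (w := W) (L := ℂ) (g := fun _ => 1)
        (Or.inl (by
          have : FreeGroup.lift (fun _ : X => (1 : Matrix.SpecialLinearGroup (Fin 2) ℂ)) = 1 := by
            ext1 x
            simp
          rw [this]
          rfl)) (ι := Empty) (x := Empty.elim) (algebraicIndependent_empty_type_iff.mpr
            (algebraMap ℂ ℂ).injective) (fun i => i.elim)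
      simpa using this
    generalize topologicalKrullDim (RepVariety {W}) = d at h0 hlt
    induction d using WithBot.recBotCoe with
    | bot => simp at h0
    | coe d =>
      induction d using ENat.recTopCoe with
      | top => exact (hlt le_top).elim
      | coe e => exact ⟨e, rfl⟩
  have he3 : e < 3 * Fintype.card X := by
    rw [he] at hlt
    exact not_le.mp fun h => hlt (by exact_mod_cast h)
  have hmax : max ((3 * Fintype.card X : ℕ) : WithBot ℕ∞) ((e : WithBot ℕ∞) + 2) =
      ((max (3 * Fintype.card X) (e + 2) : ℕ) : WithBot ℕ∞) := by
    push_cast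
    rfl
  obtain ⟨L, _, _, g, x, hg, hgp, hx, hmem⟩ := exists_generic_pinched hp he.ge
  have hrel := (lift_pinched_iff (W := W) (p := p) g).mpr (by
    rw [hgp, neg_neg]
    exact hg.symm)
  have hdim : topologicalKrullDim (RepVariety (pinchedRelators W p)) =
      ((max (3 * Fintype.card X) (e + 2) : ℕ) : WithBot ℕ∞) := by
    refine le_antisymm ?_ ?_
    · by_contra hcon
      rcases le_or_exists_le_of_natCast_le_pinched hp
        (WithBot.natCast_succ_le_of_not_le hcon) with h | ⟨k, hk, h⟩
      · omega
      · rw [he] at hk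
        have : k ≤ e := by exact_mod_cast hk
        omega
    · rw [← hmax]
      refine max_le (natCast_le_topologicalKrullDim_pinched hp) ?_
      have := natCast_le_topologicalKrullDim_of_generic hrel hx hmem
      rw [Fintype.card_sum, Fintype.card_fin, Fintype.card_fin, add_comm] at this
      exact_mod_cast this
  rw [he, hmax]
  refine ⟨⟨hdim, by exact_mod_cast (by omega : max (3 * Fintype.card X) (e + 2) ≤ _)⟩, ?_⟩
  intro hge hirr
  have hge' : 3 * Fintype.card X ≤ e + 2 := by exact_mod_cast hge
  have : PreirreducibleSpace
      (RepVariety {FreeGroup.map some W * (FreeGroup.of none ^ p)⁻¹}) := hirr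
  -- Irreducibility would force dimension at least `e + 3`, but the dimension is `max (3n) (e + 2) =
  -- e + 2`.
  have h := natCast_succ_le_topologicalKrullDim_of_preirreducibleSpace hrel hx hmem
    (repLocus_ker_ne_univ hp hW hg)
  rw [Fintype.card_sum, Fintype.card_fin, Fintype.card_fin] at h
  have h' := h.trans hdim.le
  have : 2 + e + 1 ≤ max (3 * Fintype.card X) (e + 2) := by exact_mod_cast h'
  omega
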